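/- Let $X,U$ be finite-dimensional real Hilbert spaces, $\Theta$ an open subset of a finite-dimensional Euclidean space $T$, $Y$ a set of observations and $y\in Y$ fixed. Let $K:X\to U$ be linear, and let $H(\cdot,y,\theta):X\to\mathbb R\cup\{+\infty\}$ and $G(\cdot,y,\theta):U\to\mathbb R\cup\{+\infty\}$ be proper, closed and convex for every $\theta\in\Theta$. Write $\operatorname{Prox}_f(x)=\operatorname{argmin}_z \tfrac12\|z-x\|^2+f(z)$ and $f^*(u)=\sup_z\langle z,u\rangle-f(z)$; let $\operatorname{Prox}_{\xi H}(x,y,\theta)$ denote $\operatorname{Prox}_{\xi H(\cdot,y,\theta)}(x)$, and $\operatorname{Prox}_{\tau G^*}(u,y,\theta)$ denote $\operatorname{Prox}_{\tau (G(\cdot,y,\theta))^*}(u)$. Let $\tau,\xi>0$ and $\zeta\in\mathbb R$. From an initial point $a^{(0)}(y,\theta)\in X\times X\times U$, the Chambolle–Pock primal–dual algorithm computes $a^{(\ell)}=(x^{(\ell)},\tilde x^{(\ell)},u^{(\ell)})$ by $a^{(\ell+1)}=\psi(a^{(\ell)},y,\theta)$, that is, $$u^{(\ell+1)}=\operatorname{Prox}_{\tau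 G^*}(U^{(\ell)},y,\theta),\quad U^{(\ell)}=u^{(\ell)}+\tau K\tilde x^{(\ell)},$$ $$x^{(\ell+1)}=\operatorname{Prox}_{\xi H}(X^{(\ell)},y,\theta),\quad X^{(\ell)}=x^{(\ell)}-\xi K^*u^{(\ell+1)},$$ $$\tilde x^{(\ell+1)}=x^{(\ell+1)}+\zeta(x^{(\ell+1)}-x^{(\ell)}),$$ with output $x^{(\ell)}=\gamma(a^{(\ell)})$, where $\gamma(x,\tilde x,u)=x$. Assume that $\theta\mapsto\psi(a,y,\theta)$ is Lipschitz on $\Theta$ with a constant independent of $a$, and that $\theta\mapsto a^{(0)}(y,\theta)$ is Lipschitz on $\Theta$. Then all the iterates $\theta\mapsto a^{(\ell)},x^{(\ell)},\tilde x^{(\ell)},u^{(\ell)}$ are weakly differentiable on $\Theta$. Moreover, there are versions $J_\psi=(\partial_1\psi,\partial_3\psi)$, $J_G=(\partial_1\operatorname{Prox}_{\tau G^*},\partial_3\operatorname{Prox}_{\tau G^*})$ and $J_H=(\partial_1\operatorname{Prox}_{\xi H},\partial_3\operatorname{Prox}_{\xi H})$ of the weak Jacobians on $(X\times X\times U)\times\Theta$,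 $U\times\Theta$ and $X\times\Theta$ of the maps $(a,\theta)\mapsto\psi(a,y,\theta)$, $(u,\theta)\mapsto\operatorname{Prox}_{\tau G^*}(u,y,\theta)$ and $(x,\theta)\mapsto\operatorname{Prox}_{\xi H}(x,y,\theta)$, each equal to the Fréchet derivative at every point where the map is differentiable and with values everywhere in Clarke's generalized Jacobian (the convex hull of the limits of derivatives at nearby points of differentiability), with the following property. For any weak Jacobians $J_a^{(\ell)},J_x^{(\ell)},J_{\tilde x}^{(\ell)},J_u^{(\ell)}$ with respect to $\theta$ of $a^{(\ell)},x^{(\ell)},\tilde x^{(\ell)},u^{(\ell)}$, every $\ell\ge0$ and almost every $\theta\in\Theta$, $$J_x^{(\ell)}=\Gamma_a^{(\ell)}J_a^{(\ell)},\qquad J_a^{(\ell+1)}=\Psi_a^{(\ell)}J_a^{(\ell)}+\Psi_\theta^{(\ell)},$$ $$J_u^{(\ell+1)}=\mathcal G_u^{(\ell)}\bigl(J_u^{(\ell)}+\tau KJ_{\tilde x}^{(\ell)}\bigr)+\mathcal G_\theta^{(\ell)},$$ $$J_x^{(\ell+1)}=\mathcal H_x^{(\ell)}\bigl(J_x^{(\ell)}-\xi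 K^*J_u^{(\ell+1)}\bigr)+\mathcal H_\theta^{(\ell)},$$ $$J_{\tilde x}^{(\ell+1)}=J_x^{(\ell+1)}+\zeta\bigl(J_x^{(\ell+1)}-J_x^{(\ell)}\bigr),$$ where $\Gamma_a^{(\ell)}$ is the derivative of $\gamma$ at $a^{(\ell)}$, $(\Psi_a^{(\ell)},\Psi_\theta^{(\ell)})=(\partial_1\psi,\partial_3\psi)(a^{(\ell)},y,\theta)$, $(\mathcal G_u^{(\ell)},\mathcal G_\theta^{(\ell)})=(\partial_1\operatorname{Prox}_{\tau G^*},\partial_3\operatorname{Prox}_{\tau G^*})(U^{(\ell)},y,\theta)$ and $(\mathcal H_x^{(\ell)},\mathcal H_\theta^{(\ell)})=(\partial_1\operatorname{Prox}_{\xi H},\partial_3\operatorname{Prox}_{\xi H})(X^{(\ell)},y,\theta)$. -/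

import Mathlib

open MeasureTheory Set Filter
open scoped NNReal Topology

namespace PrimalDual

noncomputable section

/-! ### Convex analysis -/

section Convex

variable {E : Type*} [NormedAddCommGroup E] [InnerProductSpace ℝ E]

/-- A proper closed (lower semicontinuous) convex function with values in `ℝ ∪ {+∞}`; convexity is
convexity of the epigraph. -/
structure IsProperClosedConvex (f : E → EReal) : Prop where
  ne_bot : ∀ x, f x ≠ ⊥
  exists_ne_top : ∃ x, f x ≠ ⊤
  closed : LowerSemicontinuous f
  convex : Convex ℝ {p : E × ℝ | f p.1 ≤ (p.2 : EReal)}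

/-- `p` minimizes `z ↦ ½ ‖z - x‖² + f z`. -/
def IsProxPoint (f : E → EReal) (x p : E) : Prop :=
  ∀ z : E, ((1 / 2 * ‖p - x‖ ^ 2 : ℝ) : EReal) + f p ≤ ((1 / 2 * ‖z - x‖ ^ 2 : ℝ) : EReal) + f z

/-- The proximity operator: `prox f x` is the minimizer of `z ↦ ½ ‖z - x‖² + f z`, which exists and
is unique when `f` is proper closed convex. -/
def prox (f : E → EReal) (x : E) : E :=
  Classical.epsilon (IsProxPoint f x)

/-- The Legendre–Fenchel conjugate `f*(u) = sup_z ⟨z, u⟩ - f z`. -/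
def conjugate (f : E → EReal) (u : E) : EReal :=
  ⨆ z : E, ((inner ℝ z u : ℝ) : EReal) - f z

end Convex

/-! ### Weak Jacobians and generalized Jacobians -/

section Weak

variable {E F : Type*} [NormedAddCommGroup E] [NormedSpace ℝ E]
  [NormedAddCommGroup F] [NormedSpace ℝ F]

/-- `J` is (a version of) the weak Jacobian of `f` on the open set `Ω`: both are locally integrable
on `Ω` and the integration by parts formula holds, in every direction `v`, against all `C¹` test
functions with compact support in `Ω`. -/
structure IsWeakJacobian [MeasureSpace E] (f : E → F) (Ω : Set E) (J : E → E →L[ℝ] F) : Prop where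
  locallyIntegrableOn : LocallyIntegrableOn f Ω volume
  locallyIntegrableOn_jacobian : LocallyIntegrableOn J Ω volume
  integral_eq : ∀ φ : E → ℝ, ContDiff ℝ 1 φ → HasCompactSupport φ → tsupport φ ⊆ Ω →
    ∀ v : E, ∫ a in Ω, φ a • J a v = - ∫ a in Ω, (fderiv ℝ φ a v) • f a

/-- `f` is weakly differentiable on the open set `Ω`. -/
def IsWeaklyDifferentiableOn [MeasureSpace E] (f : E → F) (Ω : Set E) : Prop :=
  ∃ J : E → E →L[ℝ] F, IsWeakJacobian f Ω J

/-- Clarke's generalized Jacobian of `f` at `p`: the convex hull of all limits of (Fréchet)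
derivatives of `f` at points of differentiability tending to `p`. -/
def clarkeJacobian (f : E → F) (p : E) : Set (E →L[ℝ] F) :=
  convexHull ℝ {A | ∃ q : ℕ → E, (∀ n, DifferentiableAt ℝ f (q n)) ∧ Tendsto q atTop (𝓝 p) ∧
    Tendsto (fun n => fderiv ℝ f (q n)) atTop (𝓝 A)}

/-- A version of the weak Jacobian of `f` on the open set `Ω` which is meaningful at every point of
`Ω`: it is the classical derivative wherever `f` is differentiable, and its values always lie in
Clarke's generalized Jacobian. -/
structure IsJacobianVersion [MeasureSpace E] (f : E → F) (Ω : Set E) (J : E → E →L[ℝ] F) :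
    Prop where
  isWeakJacobian : IsWeakJacobian f Ω J
  eq_fderiv : ∀ p ∈ Ω, DifferentiableAt ℝ f p → J p = fderiv ℝ f p
  mem_clarkeJacobian : ∀ p ∈ Ω, J p ∈ clarkeJacobian f p

end Weak

section Blocks

variable {E T F : Type*} [NormedAddCommGroup E] [NormedSpace ℝ E]
  [NormedAddCommGroup T] [NormedSpace ℝ T] [NormedAddCommGroup F] [NormedSpace ℝ F]

/-- The block of a Jacobian on `E × T` acting on the variable in `E`. -/
def varBlock (A : E × T →L[ℝ] F) : E →L[ℝ] F :=
  A.comp (ContinuousLinearMap.inl ℝ E T)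

/-- The block of a Jacobian on `E × T` acting on the parameter in `T`. -/
def paramBlock (A : E × T →L[ℝ] F) : T →L[ℝ] F :=
  A.comp (ContinuousLinearMap.inr ℝ E T)

end Blocks

/-! ### The primal–dual algorithm -/

section Algorithm

variable {X U Y T : Type*}
  [NormedAddCommGroup X] [InnerProductSpace ℝ X] [CompleteSpace X]
  [NormedAddCommGroup U] [InnerProductSpace ℝ U] [CompleteSpace U]

/-- `Prox_{ξ H}(x, y, θ)`. -/
def proxPrimal (ξ : ℝ) (H : X → Y → T → EReal) (x : X) (y : Y) (θ : T) : X :=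
  prox (fun z => (ξ : EReal) * H z y θ) x

/-- `Prox_{τ G*}(u, y, θ)`, the conjugate being taken in the first variable. -/
def proxDual (τ : ℝ) (G : U → Y → T → EReal) (u : U) (y : Y) (θ : T) : U :=
  prox (fun v => (τ : EReal) * conjugate (fun z => G z y θ) v) u

/-- The dual point `u + τ K x̃`, for `a = (x, x̃, u)`. -/
def dualPoint (τ : ℝ) (K : X →L[ℝ] U) (a : X × X × U) : U :=
  a.2.2 + τ • K a.2.1

/-- The primal point `x - ξ K* u⁺`, for `a = (x, x̃, u)` and the updated dual variable `u⁺`. -/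
def primalPoint (ξ : ℝ) (K : X →L[ℝ] U) (a : X × X × U) (u' : U) : X :=
  a.1 - ξ • ContinuousLinearMap.adjoint K u'

/-- One step `a ↦ ψ(a, y, θ)` of the primal–dual algorithm on `a = (x, x̃, u)`. -/
def step (τ ξ ζ : ℝ) (K : X →L[ℝ] U) (H : X → Y → T → EReal) (G : U → Y → T → EReal)
    (a : X × X × U) (y : Y) (θ : T) : X × X × U :=
  let u' := proxDual τ G (dualPoint τ K a) y θ
  let x' := proxPrimal ξ H (primalPoint ξ K a u') y θ
  (x', x' + ζ • (x' - a.1), u')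

/-- The iterates `a^(ℓ)(y, θ) = (x^(ℓ), x̃^(ℓ), u^(ℓ))(y, θ)` from the initial point `a₀(y, θ)`. -/
def iter (τ ξ ζ : ℝ) (K : X →L[ℝ] U) (H : X → Y → T → EReal) (G : U → Y → T → EReal)
    (a₀ : Y → T → X × X × U) : ℕ → Y → T → X × X × U
  | 0 => a₀
  | ℓ + 1 => fun y θ => step τ ξ ζ K H G (iter τ ξ ζ K H G a₀ ℓ y θ) y θ

/-- The output map `γ`, which reads the primal iterate `x` off `a = (x, x̃, u)`. -/
def output (a : X × X × U) : X := a.1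

end Algorithm

end

end PrimalDual

/-! Proximity operators are nonexpansive (`IsProperClosedConvex.norm_prox_sub_le`), for the
conjugate as well, so one step of the algorithm is Lipschitz in `a` uniformly in `θ`. With the
assumed Lipschitz dependence on `θ`, the step and both proximity operators are jointly Lipschitz,
and hence every iterate is Lipschitz in `θ`. By Rademacher's theorem and integration by parts, the
weak Jacobian of a Lipschitz map is its classical derivative almost everywhere; weak
differentiability follows, and each recursion becomes an identity between derivatives at almost
every `θ`.

The obstacle is the chain rule for `θ ↦ f (c θ, θ)` with `f` merely Lipschitz: the graph of `c` is a
null set, on which `f` may be nowhere differentiable, so an almost everywhere derivative of `f` says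
nothing there. Clarke's generalized Jacobian repairs this. If a curve has derivative `D` and its
image under `f` has derivative `B`, some element `A` of the generalized Jacobian satisfies `A ∘ D =
B` (`exists_mem_clarkeJacobian_comp_eq`). To see this, smooth `f` at a scale much smaller than that
at which the derivative along `D` is read, and average the derivatives of the smoothed map: the
averages are limits of convex combinations of nearby derivatives of `f`, and integration by parts
shows that along `D` they tend to `B`.

The version of the Jacobian is then defined pointwise by choosing such an `A` wherever `f` is not
differentiable (`exists_isJacobianVersion_chain`). One `A` must serve all iterates through the same
point; this is possible for almost every `θ`, since two Lipschitz curves have equal derivatives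
almost everywhere on their coincidence set. -/

namespace PrimalDual

/-! ### Proximity operators: existence, nonexpansiveness, stability under scaling and conjugation.
-/

section Prox

variable {E : Type*} [NormedAddCommGroup E] [InnerProductSpace ℝ E] {f : E → EReal}

/-- The inequality that characterizes convexity along segments, between points of finite value. -/
theorem IsProperClosedConvex.segment_le (hf : IsProperClosedConvex f) {x y : E} {α β t : ℝ}
    (hx : f x ≤ α) (hy : f y ≤ β) (ht : 0 ≤ t) (ht' : t ≤ 1) :
    f (x + t • (y - x)) ≤ ((α + t * (β - α) : ℝ) : EReal) := by
  have h := hf.convex (x := (x, α)) hx (y := (y, β)) hy (sub_nonneg.2 ht') ht (by ring)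
  have e : (1 - t) • x + t • y = x + t • (y - x) := by module
  have e' : (1 - t) * α + t * β = α + t * (β - α) := by ring
  simpa [e, e'] using h

theorem IsProperClosedConvex.exists_coe (hf : IsProperClosedConvex f) :
    ∃ (x : E) (α : ℝ), f x = α := by
  obtain ⟨x, hx⟩ := hf.exists_ne_top
  exact ⟨x, (f x).toReal, (EReal.coe_toReal hx (hf.ne_bot x)).symm⟩

theorem IsProxPoint.exists_coe (hf : IsProperClosedConvex f) {x p : E} (hp : IsProxPoint f x p) :
    ∃ α : ℝ, f p = α := by
  obtain ⟨z, β, hz⟩ := hf.exists_coe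
  refine ⟨(f p).toReal, (EReal.coe_toReal (fun h => ?_) (hf.ne_bot p)).symm⟩
  have := hp z
  rw [h, hz, EReal.coe_add_top, ← EReal.coe_add] at this
  exact EReal.coe_ne_top _ (top_le_iff.1 this)

/-- The variational inequality satisfied by a proximal point. -/
theorem IsProxPoint.sub_le_inner (hf : IsProperClosedConvex f) {x p z : E} {α β : ℝ}
    (hp : IsProxPoint f x p) (hα : f p = α) (hβ : f z ≤ β) :
    α - β ≤ inner ℝ (z - p) (p - x) := by
  -- Minimality of `p` is tested at `p + t (z - p)`; after division by `t`, the quadratic remainder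
  -- disappears as `t → 0`.
  have key : ∀ t : ℝ, 0 < t → t ≤ 1 →
      α - β ≤ inner ℝ (z - p) (p - x) + t * (1 / 2 * ‖z - p‖ ^ 2) := by
    intro t ht ht'
    have h1 := hp (p + t • (z - p))
    have h2 := h1.trans (add_le_add le_rfl (hf.segment_le hα.le hβ ht.le ht'))
    rw [hα, ← EReal.coe_add, ← EReal.coe_add, EReal.coe_le_coe_iff] at h2
    have e : p + t • (z - p) - x = (p - x) + t • (z - p) := by abel
    rw [e, norm_add_sq_real, norm_smul, inner_smul_right, real_inner_comm, Real.norm_eq_abs,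
      mul_pow, sq_abs] at h2
    have : t * (α - β) ≤ t * (inner ℝ (z - p) (p - x) + t * (1 / 2 * ‖z - p‖ ^ 2)) := by
      nlinarith
    exact le_of_mul_le_mul_left this ht
  have hlim : Tendsto (fun t : ℝ => inner ℝ (z - p) (p - x) + t * (1 / 2 * ‖z - p‖ ^ 2))
      (𝓝[>] 0) (𝓝 (inner ℝ (z - p) (p - x))) := by
    have : Continuous (fun t : ℝ => inner ℝ (z - p) (p - x) + t * (1 / 2 * ‖z - p‖ ^ 2)) := by
      fun_prop
    simpa using (this.tendsto 0).mono_left nhdsWithin_le_nhds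
  refine ge_of_tendsto hlim ?_
  filter_upwards [Ioc_mem_nhdsGT (zero_lt_one' ℝ)] with t ht using key t ht.1 ht.2

/-- Adding the variational inequalities of `p` and `p'`, each tested at the other point, gives `‖p -
p'‖² ≤ ⟨p - p', x - x'⟩`; Cauchy–Schwarz concludes. -/
theorem IsProxPoint.norm_sub_le (hf : IsProperClosedConvex f) {x x' p p' : E}
    (hp : IsProxPoint f x p) (hp' : IsProxPoint f x' p') : ‖p - p'‖ ≤ ‖x - x'‖ := by
  obtain ⟨α, hα⟩ := hp.exists_coe hf
  obtain ⟨β, hβ⟩ := hp'.exists_coe hf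
  have h1 := hp.sub_le_inner hf hα hβ.le
  have h2 := hp'.sub_le_inner hf hβ hα.le
  have e1 : inner ℝ (p' - p) (p - x) = - inner ℝ (p - p') (p - x) := by
    rw [← neg_sub p p', inner_neg_left]
  have e2 : inner ℝ (p - p') (p - x) - inner ℝ (p - p') (p' - x') =
      ‖p - p'‖ ^ 2 - inner ℝ (p - p') (x - x') := by
    rw [← inner_sub_right, ← real_inner_self_eq_norm_sq, ← inner_sub_right]
    congr 1
    abel
  have h3 := real_inner_le_norm (p - p') (x - x')
  have h4 : ‖p - p'‖ * ‖p - p'‖ ≤ ‖p - p'‖ * ‖x - x'‖ := by nlinarith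
  rcases (norm_nonneg (p - p')).eq_or_lt with h | h
  · rw [← h]; exact norm_nonneg _
  · exact le_of_mul_le_mul_left h4 h

theorem lowerSemicontinuous_coe_add {α : Type*} [TopologicalSpace α] {f : α → EReal} {g : α → ℝ}
    (hg : Continuous g) (hf : LowerSemicontinuous f) :
    LowerSemicontinuous fun x => ((g x : ℝ) : EReal) + f x := by
  refine LowerSemicontinuous.add' ?_ hf fun x => ?_
  · exact (continuous_coe_real_ereal.comp hg).lowerSemicontinuous
  · exact EReal.continuousAt_add (Or.inl (EReal.coe_ne_top _)) (Or.inl (EReal.coe_ne_bot _))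

/-- A proper closed convex function decreases at most linearly. -/
theorem IsProperClosedConvex.exists_linear_lower_bound [FiniteDimensional ℝ E]
    (hf : IsProperClosedConvex f) (x : E) :
    ∃ C : ℝ, ∀ z, ((-C * (‖z - x‖ + 1) : ℝ) : EReal) ≤ f z := by
  obtain ⟨w, α, hw⟩ := hf.exists_coe
  obtain ⟨q, -, hq⟩ := LowerSemicontinuousOn.exists_isMinOn (s := Metric.closedBall w 1)
    ⟨w, by simp⟩ (isCompact_closedBall w 1) (hf.closed.lowerSemicontinuousOn _)
  have hqw : f q ≤ α := hw ▸ hq (by simp : w ∈ Metric.closedBall w 1)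
  obtain ⟨m, hm⟩ : ∃ m : ℝ, f q = m := ⟨(f q).toReal, (EReal.coe_toReal
    (ne_top_of_le_ne_top (EReal.coe_ne_top α) hqw) (hf.ne_bot q)).symm⟩
  have hmα : m ≤ α := by rw [hm] at hqw; exact_mod_cast hqw
  -- In the unit ball around `w` the minimum `m` is a lower bound. Outside it, convexity on the
  -- segment from `w` to `z`, read at distance one from `w` where `f` is at least `m`, gives `f z ≥
  -- α - (α - m) ‖z - w‖`.
  have key : ∀ z, ((m - (α - m) * ‖z - w‖ - |α| : ℝ) : EReal) ≤ f z := by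
    intro z
    rcases le_or_gt ‖z - w‖ 1 with hz | hz
    · have h1 : f q ≤ f z := hq (by simpa [dist_eq_norm] using hz)
      rw [hm] at h1
      refine le_trans ?_ h1
      rw [EReal.coe_le_coe_iff]
      nlinarith [abs_nonneg α, norm_nonneg (z - w)]
    · induction hβ : f z with
      | bot => exact absurd hβ (hf.ne_bot z)
      | top => exact le_top
      | coe β =>
        have hpos : 0 < ‖z - w‖ := by linarith
        have h1 := hf.segment_le hw.le hβ.le (inv_nonneg.2 hpos.le)
          (inv_le_one_of_one_le₀ hz.le)
        have h2 : f q ≤ f (w + ‖z - w‖⁻¹ • (z - w)) := by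
          refine hq ?_
          simp [dist_eq_norm, norm_smul, hpos.ne']
        rw [hm] at h2
        have h3 := EReal.coe_le_coe_iff.1 (h2.trans h1)
        rw [EReal.coe_le_coe_iff]
        have h4 : ‖z - w‖ * m ≤ ‖z - w‖ * α + (β - α) := by
          have := mul_le_mul_of_nonneg_left h3 hpos.le
          rw [mul_add, ← mul_assoc, mul_inv_cancel₀ hpos.ne', one_mul] at this
          exact this
        have := neg_abs_le α
        have := le_abs_self α
        nlinarith
  refine ⟨|m| + |α| + (α - m) * (‖x - w‖ + 1), fun z => le_trans ?_ (key z)⟩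
  rw [EReal.coe_le_coe_iff]
  have h1 : ‖z - w‖ ≤ ‖z - x‖ + ‖x - w‖ := norm_sub_le_norm_sub_add_norm_sub z x w
  have h2 := mul_le_mul_of_nonneg_left h1 (sub_nonneg.2 hmα)
  have h3 := neg_abs_le m
  have h4 : 0 ≤ ‖z - x‖ := norm_nonneg _
  have h5 : 0 ≤ ‖x - w‖ := norm_nonneg _
  have h6 := mul_nonneg h4 (abs_nonneg m)
  have h7 := mul_nonneg h4 (abs_nonneg α)
  have h8 := mul_nonneg (mul_nonneg (sub_nonneg.2 hmα) h4) h5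
  have h9 := sub_nonneg.2 hmα
  nlinarith

theorem IsProperClosedConvex.exists_isProxPoint [FiniteDimensional ℝ E]
    (hf : IsProperClosedConvex f) (x : E) : ∃ p, IsProxPoint f x p := by
  obtain ⟨C, hC⟩ := hf.exists_linear_lower_bound x
  obtain ⟨w, α, hw⟩ := hf.exists_coe
  set M : ℝ := 1 / 2 * ‖w - x‖ ^ 2 + α with hM
  -- `M` is the objective at `w`. `R` is large enough that beyond it the quadratic term beats the
  -- linear lower bound and the objective exceeds `M`, so a minimizer on the ball is global.
  set R : ℝ := ‖w - x‖ + 2 * (|C| + |M|) + 2 with hR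
  have hlsc : LowerSemicontinuous fun z => ((1 / 2 * ‖z - x‖ ^ 2 : ℝ) : EReal) + f z :=
    lowerSemicontinuous_coe_add (by fun_prop) hf.closed
  have hwR : w ∈ Metric.closedBall x R := by
    rw [Metric.mem_closedBall, dist_eq_norm, hR]
    have := abs_nonneg C
    have := abs_nonneg M
    linarith
  obtain ⟨p, -, hp⟩ := LowerSemicontinuousOn.exists_isMinOn ⟨w, hwR⟩
    (isCompact_closedBall x R) (hlsc.lowerSemicontinuousOn _)
  refine ⟨p, fun z => ?_⟩
  by_cases hz : z ∈ Metric.closedBall x R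
  · exact hp hz
  · refine (hp hwR).trans ?_
    show ((1 / 2 * ‖w - x‖ ^ 2 : ℝ) : EReal) + f w ≤ _
    refine le_trans ?_ (add_le_add le_rfl (hC z))
    rw [hw, ← EReal.coe_add, ← EReal.coe_add, EReal.coe_le_coe_iff, ← hM]
    rw [Metric.mem_closedBall, dist_eq_norm, not_le] at hz
    set n := ‖z - x‖
    have h0 : 0 ≤ ‖w - x‖ := norm_nonneg _
    have h1 := abs_nonneg C
    have h2 := le_abs_self C
    have h3 := le_abs_self M
    have h4 := abs_nonneg M
    have hn : 2 * (|C| + |M|) + 2 ≤ n := by linarith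
    have h5 : C * (n + 1) ≤ |C| * (n + 1) := by
      exact mul_le_mul_of_nonneg_right h2 (by linarith)
    have h6 : (2 * (|C| + |M|) + 2) * n ≤ n * n := mul_le_mul_of_nonneg_right hn (by linarith)
    have h7 : |M| * 1 ≤ |M| * n := mul_le_mul_of_nonneg_left (by linarith) h4
    have h8 : |C| ≤ n := by linarith
    nlinarith

theorem IsProperClosedConvex.isProxPoint_prox [FiniteDimensional ℝ E]
    (hf : IsProperClosedConvex f) (x : E) : IsProxPoint f x (prox f x) :=
  Classical.epsilon_spec (hf.exists_isProxPoint x)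

theorem IsProperClosedConvex.norm_prox_sub_le [FiniteDimensional ℝ E]
    (hf : IsProperClosedConvex f) (x x' : E) : ‖prox f x - prox f x'‖ ≤ ‖x - x'‖ :=
  (hf.isProxPoint_prox x).norm_sub_le hf (hf.isProxPoint_prox x')

theorem coe_mul_le_coe_iff {c r : ℝ} (hc : 0 < c) (a : EReal) :
    (c : EReal) * a ≤ r ↔ a ≤ ((r / c : ℝ) : EReal) := by
  rw [EReal.coe_div, EReal.le_div_iff_mul_le (by exact_mod_cast hc) (EReal.coe_ne_top c), mul_comm]

theorem IsProperClosedConvex.const_mul (hf : IsProperClosedConvex f) {c : ℝ} (hc : 0 < c) :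
    IsProperClosedConvex fun x => (c : EReal) * f x where
  ne_bot x h := by
    rcases EReal.mul_eq_bot _ _ |>.1 h with h | h | h | h
    · exact EReal.coe_ne_bot _ h.1
    · exact hf.ne_bot x h.2
    · exact EReal.coe_ne_top _ h.1
    · exact absurd (by exact_mod_cast h.1) hc.not_gt
  exists_ne_top := by
    obtain ⟨x, α, hx⟩ := hf.exists_coe
    exact ⟨x, by rw [hx, ← EReal.coe_mul]; exact EReal.coe_ne_top _⟩
  closed := by
    refine lowerSemicontinuous_iff_isOpen_preimage.2 fun r => ?_
    have hc' : (0 : EReal) < c := by exact_mod_cast hc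
    have : (fun x => (c : EReal) * f x) ⁻¹' Ioi r = f ⁻¹' Ioi (r / c) := by
      ext x
      simp only [mem_preimage, mem_Ioi, EReal.div_lt_iff hc' (EReal.coe_ne_top c), mul_comm]
    rw [this]
    exact lowerSemicontinuous_iff_isOpen_preimage.1 hf.closed _
  convex := by
    have h := hf.convex.linear_preimage
      (LinearMap.prodMap (LinearMap.id : E →ₗ[ℝ] E) (c⁻¹ • (LinearMap.id : ℝ →ₗ[ℝ] ℝ)))
    have e : {p : E × ℝ | (c : EReal) * f p.1 ≤ (p.2 : EReal)} = (LinearMap.prodMap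
        (LinearMap.id : E →ₗ[ℝ] E) (c⁻¹ • (LinearMap.id : ℝ →ₗ[ℝ] ℝ))) ⁻¹'
          {p : E × ℝ | f p.1 ≤ (p.2 : EReal)} := by
      ext p
      simp only [mem_ofPred_eq, coe_mul_le_coe_iff hc, mem_preimage, LinearMap.prodMap_apply,
        LinearMap.id_apply, LinearMap.smul_apply, smul_eq_mul, div_eq_inv_mul]
    rw [e]
    exact h

/-- A supremum of affine functions is closed and convex, and properness of `f` excludes the value
`⊥`. Finiteness somewhere amounts to an affine minorant of `f`, which the variational inequality at
a proximal point supplies. -/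
theorem IsProperClosedConvex.conjugate [FiniteDimensional ℝ E] (hf : IsProperClosedConvex f) :
    IsProperClosedConvex (conjugate f) where
  ne_bot u h := by
    obtain ⟨x, α, hx⟩ := hf.exists_coe
    have h1 : ((inner ℝ x u : ℝ) : EReal) - f x ≤ PrimalDual.conjugate f u :=
      le_iSup (fun z : E => ((inner ℝ z u : ℝ) : EReal) - f z) x
    rw [h, hx, ← EReal.coe_sub] at h1
    exact EReal.coe_ne_bot _ (le_bot_iff.1 h1)
  exists_ne_top := by
    obtain ⟨p, hp⟩ := hf.exists_isProxPoint 0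
    obtain ⟨α, hα⟩ := hp.exists_coe hf
    -- The variational inequality of `p = prox f 0` reads `f p - f z ≤ ⟨z, p⟩ - ‖p‖²`, so the
    -- conjugate at `-p` is at most `-‖p‖² - f p`.
    refine ⟨-p, ne_top_of_le_ne_top (EReal.coe_ne_top (-‖p‖ ^ 2 - α)) (iSup_le fun z => ?_)⟩
    induction hβ : f z with
    | bot => exact absurd hβ (hf.ne_bot z)
    | top => simp
    | coe β =>
      have h := hp.sub_le_inner hf hα hβ.le
      rw [← EReal.coe_sub, EReal.coe_le_coe_iff, inner_neg_right]
      rw [sub_zero, inner_sub_left, real_inner_self_eq_norm_sq] at h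
      linarith
  closed := by
    refine lowerSemicontinuous_iSup fun z => Continuous.lowerSemicontinuous ?_
    induction hβ : f z with
    | bot => exact absurd hβ (hf.ne_bot z)
    | top => simpa using continuous_const
    | coe β =>
      simp only [← EReal.coe_sub]
      exact continuous_coe_real_ereal.comp (by fun_prop)
  convex := by
    have : {p : E × ℝ | PrimalDual.conjugate f p.1 ≤ (p.2 : EReal)} =
        ⋂ z : E, {p : E × ℝ | ((inner ℝ z p.1 : ℝ) : EReal) - f z ≤ (p.2 : EReal)} := by
      ext p
      simp [PrimalDual.conjugate]
    rw [this]
    refine convex_iInter fun z => ?_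
    induction hβ : f z with
    | bot => exact absurd hβ (hf.ne_bot z)
    | top => simpa using convex_univ
    | coe β =>
      simp only [← EReal.coe_sub, EReal.coe_le_coe_iff]
      intro p hp q hq a b ha hb hab
      simp only [mem_ofPred_eq, Prod.fst_add, Prod.snd_add, Prod.smul_fst, Prod.smul_snd,
        inner_add_right, inner_smul_right, smul_eq_mul] at *
      have h1 := mul_le_mul_of_nonneg_left hp ha
      have h2 := mul_le_mul_of_nonneg_left hq hb
      have h3 : (a + b) * β = β := by rw [hab, one_mul]
      nlinarith

end Prox

/-! ### Weak Jacobians of Lipschitz maps, and derivatives on coincidence sets. -/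

section WeakJacobian

theorem IsWeakJacobian.integrable_smul_apply {E F : Type*} [NormedAddCommGroup E]
    [NormedSpace ℝ E] [NormedAddCommGroup F] [NormedSpace ℝ F] [MeasureSpace E] [BorelSpace E]
    {f : E → F} {Ω : Set E} {J : E → E →L[ℝ] F} (hJ : IsWeakJacobian f Ω J) {φ : E → ℝ}
    (hφ : Continuous φ) (hφc : HasCompactSupport φ) (hφΩ : tsupport φ ⊆ Ω) (v : E) :
    Integrable (fun a => φ a • J a v) (volume.restrict Ω) := by
  have h1 : IntegrableOn J (tsupport φ) (volume.restrict Ω) :=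
    (hJ.locallyIntegrableOn_jacobian.integrableOn_compact_subset hφΩ hφc).mono_measure
      Measure.restrict_le_self
  have h2 : Integrable (fun a => φ a • J a) (volume.restrict Ω) := by
    refine (integrableOn_iff_integrable_of_support_subset fun a ha => ?_).1
      (h1.continuousOn_smul hφ.continuousOn hφc)
    refine subset_tsupport φ fun h => ha ?_
    simp [h]
  exact h2.apply_continuousLinearMap v

variable {E F : Type*} [NormedAddCommGroup E] [NormedSpace ℝ E] [FiniteDimensional ℝ E]
  [NormedAddCommGroup F] [NormedSpace ℝ F] [FiniteDimensional ℝ F]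

section Measure

variable [MeasurableSpace E] [BorelSpace E] (μ : Measure E) [μ.IsAddHaarMeasure]

/-- Rademacher's theorem on an open set. -/
theorem ae_differentiableAt_of_lipschitzOnWith {f : E → F} {Ω : Set E} {L : ℝ≥0}
    (hΩ : IsOpen Ω) (hf : LipschitzOnWith L f Ω) :
    ∀ᵐ a ∂(μ.restrict Ω), DifferentiableAt ℝ f a := by
  filter_upwards [hf.ae_differentiableWithinAt (μ := μ) hΩ.measurableSet,
    ae_restrict_mem hΩ.measurableSet] with a ha haΩ
  exact ha.differentiableAt (hΩ.mem_nhds haΩ)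

/-- Integration by parts for Lipschitz maps, against `C¹` functions with compact support. -/
theorem integral_smul_fderiv_eq_neg_of_lipschitzWith {g : E → F} {L : ℝ≥0}
    (hg : LipschitzWith L g) {φ : E → ℝ} (hφ : ContDiff ℝ 1 φ) (hφc : HasCompactSupport φ)
    (v : E) :
    ∫ a, φ a • fderiv ℝ g a v ∂μ = - ∫ a, (fderiv ℝ φ a v) • g a ∂μ := by
  have hφ' : Continuous fun a => fderiv ℝ φ a v :=
    (hφ.continuous_fderiv one_ne_zero).clm_apply continuous_const
  have hφ'c : HasCompactSupport fun a => fderiv ℝ φ a v := hφc.fderiv_apply (𝕜 := ℝ) v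
  have hi : Integrable (fun a => (fderiv ℝ φ a v) • g a) μ :=
    (hφ'.smul hg.continuous).integrable_of_hasCompactSupport (hφ'c.smul_right)
  have hi' : Integrable (fun a => φ a • fderiv ℝ g a v) μ := by
    refine Integrable.smul_of_top_left (hφ.continuous.integrable_of_hasCompactSupport hφc) ?_
    refine memLp_top_of_bound
      ((measurable_fderiv ℝ g).aestronglyMeasurable.apply_continuousLinearMap v) (L * ‖v‖)
      (Eventually.of_forall fun a => ?_)
    exact (ContinuousLinearMap.le_opNorm _ _).trans
      (mul_le_mul_of_nonneg_right (norm_fderiv_le_of_lipschitz ℝ hg) (norm_nonneg v))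
  obtain ⟨C, hC⟩ := hφ.lipschitzWith_of_hasCompactSupport hφc one_ne_zero
  -- Continuous linear functionals separate the points of `F`, which reduces the identity to
  -- real-valued Lipschitz functions.
  have key : ∀ l : F →L[ℝ] ℝ, l (∫ a, φ a • fderiv ℝ g a v ∂μ) =
      l (- ∫ a, (fderiv ℝ φ a v) • g a ∂μ) := by
    intro l
    have hl : LipschitzWith (‖l‖₊ * L) (l ∘ g) := l.lipschitz.comp hg
    rw [map_neg, ← l.integral_comp_comm hi, ← l.integral_comp_comm hi', ← integral_neg]
    have h := hl.integral_lineDeriv_mul_eq (μ := μ) hC hφc v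
    calc ∫ a, l (φ a • fderiv ℝ g a v) ∂μ
        = ∫ a, lineDeriv ℝ (l ∘ g) a v * φ a ∂μ := by
          refine integral_congr_ae ?_
          filter_upwards [hg.ae_differentiableAt (μ := μ)] with a ha
          rw [map_smul, smul_eq_mul, mul_comm,
            (l.differentiableAt.comp a ha).lineDeriv_eq_fderiv,
            fderiv_comp a l.differentiableAt ha, l.fderiv]
          rfl
      _ = ∫ a, lineDeriv ℝ φ a (-v) * (l ∘ g) a ∂μ := h
      _ = ∫ a, -l ((fderiv ℝ φ a v) • g a) ∂μ := by
          refine integral_congr_ae (Eventually.of_forall fun a => ?_)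
          simp [((hφ.differentiable one_ne_zero) a).lineDeriv_eq_fderiv]
  exact (SeparatingDual.eq_iff_forall_dual_eq (R := ℝ)).2 key

/-- A map vanishing on a set has zero derivative at almost all points of that set. -/
theorem ae_hasFDerivAt_eq_zero_of_eqOn_zero_real {f : E → ℝ} {s : Set E} (hs : MeasurableSet s)
    (h0 : ∀ x ∈ s, f x = 0) :
    ∀ᵐ x ∂(μ.restrict s), ∀ f' : E →L[ℝ] ℝ, HasFDerivAt f f' x → f' = 0 := by
  rcases subsingleton_or_nontrivial E with hE | hE
  · exact Eventually.of_forall fun x f' _ => by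
      ext v
      rw [Subsingleton.elim v 0, map_zero, map_zero]
  obtain ⟨v, hv⟩ := exists_ne (0 : E)
  set t : Set E := s ∩ {x | DifferentiableAt ℝ f x}
  have ht : MeasurableSet t := hs.inter (measurableSet_of_differentiableAt ℝ f)
  -- The estimate `ApproximatesLinearOn.norm_fderiv_sub_le` concerns self-maps of `E`, hence the
  -- product with a fixed nonzero `v`. The constant `0` forces the derivative to vanish at almost
  -- every point.
  have happ : ApproximatesLinearOn (fun x => f x • v) (0 : E →L[ℝ] E) t 0 := by
    intro x hx y hy
    simp [h0 x hx.1, h0 y hy.1]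
  have h := happ.norm_fderiv_sub_le μ ht (fun x => (fderiv ℝ f x).smulRight v)
    fun x hx => (hx.2.hasFDerivAt.smul_const v).hasFDerivWithinAt
  rw [ae_restrict_iff' ht] at h
  rw [ae_restrict_iff' hs]
  filter_upwards [h] with x hx hxs f' hf'
  have h1 := hx ⟨hxs, hf'.differentiableAt⟩
  rw [sub_zero, nonpos_iff_eq_zero, nnnorm_eq_zero, hf'.fderiv] at h1
  ext w
  have h2 : f' w • v = 0 := by simpa using congrArg (fun A : E →L[ℝ] E => A w) h1
  simpa [hv] using h2

theorem ae_fderiv_eq_of_eqOn {f g : E → F} {s : Set E} (hs : MeasurableSet s) (h : EqOn f g s) :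
    ∀ᵐ x ∂(μ.restrict s), DifferentiableAt ℝ f x → DifferentiableAt ℝ g x →
      fderiv ℝ f x = fderiv ℝ g x := by
  let b := Module.finBasis ℝ F
  let l : Fin (Module.finrank ℝ F) → F →L[ℝ] ℝ := fun i =>
    LinearMap.toContinuousLinearMap (b.coord i)
  have key : ∀ᵐ x ∂(μ.restrict s), ∀ i, ∀ f' : E →L[ℝ] ℝ,
      HasFDerivAt (fun x => l i (f x - g x)) f' x → f' = 0 := by
    rw [ae_all_iff]
    intro i
    exact ae_hasFDerivAt_eq_zero_of_eqOn_zero_real μ hs fun x hx => by simp [h hx]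
  filter_upwards [key] with x hx hf hg
  ext w
  refine b.ext_elem fun i => ?_
  have h1 := hx i _ ((l i).hasFDerivAt.comp x (hf.hasFDerivAt.sub hg.hasFDerivAt))
  have h2 : l i (fderiv ℝ f x w - fderiv ℝ g x w) = 0 := by
    simpa using congrArg (fun A : E →L[ℝ] ℝ => A w) h1
  rw [map_sub, sub_eq_zero] at h2
  exact h2

end Measure

variable [MeasureSpace E] [BorelSpace E]

/-- Weak Jacobians are unique up to null sets. -/
theorem IsWeakJacobian.ae_eq {f : E → F} {Ω : Set E} (hΩ : IsOpen Ω)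
    {J J' : E → E →L[ℝ] F} (hJ : IsWeakJacobian f Ω J) (hJ' : IsWeakJacobian f Ω J') :
    ∀ᵐ a ∂(volume.restrict Ω), J a = J' a := by
  have key : ∀ v : E, ∀ᵐ a ∂(volume : Measure E), a ∈ Ω → J a v - J' a v = 0 := by
    intro v
    refine hΩ.ae_eq_zero_of_integral_contDiff_smul_eq_zero (f := fun a => J a v - J' a v) ?_ ?_
    · have hloc : ∀ {A : E → E →L[ℝ] F}, LocallyIntegrableOn A Ω →
          LocallyIntegrableOn (fun a => A a v) Ω := by
        intro A hA
        rw [locallyIntegrableOn_iff hΩ.isLocallyClosed] at hA ⊢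
        exact fun k hk hkc => (hA k hk hkc).apply_continuousLinearMap v
      exact (hloc hJ.locallyIntegrableOn_jacobian).sub (hloc hJ'.locallyIntegrableOn_jacobian)
    · intro φ hφ hφc hφΩ
      have h1 : ContDiff ℝ 1 φ := hφ.of_le (by exact_mod_cast le_top)
      rw [← setIntegral_eq_integral_of_forall_compl_eq_zero (s := Ω) (fun a ha => by
        rw [image_eq_zero_of_notMem_tsupport fun h => ha (hφΩ h), zero_smul])]
      simp only [smul_sub]
      rw [integral_sub (hJ.integrable_smul_apply h1.continuous hφc hφΩ v)
        (hJ'.integrable_smul_apply h1.continuous hφc hφΩ v),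
        hJ.integral_eq φ h1 hφc hφΩ v, hJ'.integral_eq φ h1 hφc hφΩ v, sub_self]
  let b := Module.finBasis ℝ E
  have h2 := ae_all_iff.2 fun i => key (b i)
  rw [ae_restrict_iff' hΩ.measurableSet]
  filter_upwards [h2] with a ha haΩ
  refine ContinuousLinearMap.coe_injective (b.ext fun i => ?_)
  exact sub_eq_zero.1 (ha i haΩ)

variable [(volume : Measure E).IsAddHaarMeasure]

/-- Agreement with `fderiv` is asked only almost everywhere, so the values of `J` on a null set may
be chosen freely, without any measurability requirement. -/
theorem isWeakJacobian_of_lipschitzOnWith {f : E → F} {Ω : Set E} {L : ℝ≥0}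
    (hΩ : IsOpen Ω) (hf : LipschitzOnWith L f Ω) {J : E → E →L[ℝ] F}
    (hJ : ∀ᵐ a ∂(volume.restrict Ω), J a = fderiv ℝ f a) : IsWeakJacobian f Ω J where
  locallyIntegrableOn := hf.continuousOn.locallyIntegrableOn hΩ.measurableSet
  locallyIntegrableOn_jacobian := by
    have hb : ∀ᵐ a ∂(volume.restrict Ω), ‖J a‖ ≤ L := by
      filter_upwards [hJ, ae_restrict_mem hΩ.measurableSet] with a ha haΩ
      rw [ha]
      exact norm_fderiv_le_of_lipschitzOn ℝ (hΩ.mem_nhds haΩ) hf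
    have hm : AEStronglyMeasurable J (volume.restrict Ω) :=
      (measurable_fderiv ℝ f).aestronglyMeasurable.congr (hJ.mono fun a ha => ha.symm)
    refine (locallyIntegrableOn_iff hΩ.isLocallyClosed).2 fun k hk hkc => ?_
    refine ⟨hm.mono_measure (Measure.restrict_mono hk le_rfl), ?_⟩
    have : IsFiniteMeasure (volume.restrict k) := ⟨by simpa using hkc.measure_lt_top⟩
    exact HasFiniteIntegral.of_bounded (C := L) (ae_mono (Measure.restrict_mono hk le_rfl) hb)
  integral_eq φ hφ hφc hφΩ v := by
    -- Integration by parts is available for globally Lipschitz maps. An extension `g` of `f`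
    -- suffices, because the test function and its derivative vanish outside `Ω`.
    obtain ⟨g, hg, hgf⟩ := hf.extend_finite_dimension
    have h := integral_smul_fderiv_eq_neg_of_lipschitzWith volume hg hφ hφc v
    have hφ0 : ∀ a ∉ Ω, φ a = 0 := fun a ha => image_eq_zero_of_notMem_tsupport fun h => ha (hφΩ h)
    have hφ0' : ∀ a ∉ Ω, fderiv ℝ φ a = 0 := fun a ha => by
      refine image_eq_zero_of_notMem_tsupport fun h => ha (hφΩ ?_)
      exact tsupport_fderiv_subset ℝ h
    rw [← setIntegral_eq_integral_of_forall_compl_eq_zero (s := Ω) (μ := volume)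
      (f := fun a => φ a • fderiv ℝ g a v) (fun a ha => by rw [hφ0 a ha, zero_smul]),
      ← setIntegral_eq_integral_of_forall_compl_eq_zero (s := Ω) (μ := volume)
      (f := fun a => (fderiv ℝ φ a v) • g a) (fun a ha => by
        rw [hφ0' a ha, zero_apply, zero_smul])] at h
    have e1 : ∫ a in Ω, φ a • J a v = ∫ a in Ω, φ a • fderiv ℝ g a v := by
      refine integral_congr_ae ?_
      filter_upwards [hJ, ae_restrict_mem hΩ.measurableSet] with a ha haΩ
      rw [ha, (hgf.eventuallyEq_of_mem (hΩ.mem_nhds haΩ)).fderiv_eq]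
    have e2 : ∫ a in Ω, (fderiv ℝ φ a v) • f a = ∫ a in Ω, (fderiv ℝ φ a v) • g a := by
      refine setIntegral_congr_fun hΩ.measurableSet fun a ha => ?_
      simp only [hgf ha]
    rw [e1, e2, h]

theorem isWeaklyDifferentiableOn_of_lipschitzOnWith {f : E → F} {Ω : Set E} {L : ℝ≥0}
    (hΩ : IsOpen Ω) (hf : LipschitzOnWith L f Ω) : IsWeaklyDifferentiableOn f Ω :=
  ⟨fderiv ℝ f, isWeakJacobian_of_lipschitzOnWith hΩ hf (Eventually.of_forall fun _ => rfl)⟩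

theorem IsWeakJacobian.ae_eq_fderiv {f : E → F} {Ω : Set E} {L : ℝ≥0} (hΩ : IsOpen Ω)
    (hf : LipschitzOnWith L f Ω) {J : E → E →L[ℝ] F} (hJ : IsWeakJacobian f Ω J) :
    ∀ᵐ a ∂(volume.restrict Ω), J a = fderiv ℝ f a :=
  hJ.ae_eq hΩ (isWeakJacobian_of_lipschitzOnWith hΩ hf (Eventually.of_forall fun _ => rfl))

end WeakJacobian

/-! ### Clarke's generalized Jacobian and smoothing of Lipschitz maps. -/

section Clarke

open Metric

/-- In finite dimension, the convex hull of a compact set is compact. -/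
theorem isCompact_convexHull_of_isCompact {V : Type*} [NormedAddCommGroup V] [NormedSpace ℝ V]
    [FiniteDimensional ℝ V] {s : Set V} (hs : IsCompact s) : IsCompact (convexHull ℝ s) := by
  rcases s.eq_empty_or_nonempty with rfl | ⟨x₀, hx₀⟩
  · simp
  -- By Carathéodory, `N` points are enough, so the hull is the continuous image of a simplex times
  -- `s ^ N`. Shorter combinations are padded with weight zero at `x₀`.
  set N := Module.finrank ℝ V + 1
  have hK : IsCompact (stdSimplex ℝ (Fin N) ×ˢ (univ.pi fun _ : Fin N => s)) :=
    (isCompact_stdSimplex ℝ (Fin N)).prod (isCompact_univ_pi fun _ => hs)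
  have hc : Continuous fun q : (Fin N → ℝ) × (Fin N → V) => ∑ i, q.1 i • q.2 i := by fun_prop
  convert hK.image hc using 1
  ext x
  constructor
  · intro hx
    obtain ⟨ι, hι, z, w, hz, hzi, hw, hw1, rfl⟩ := eq_pos_convex_span_of_mem_convexHull hx
    have hcard : Fintype.card ι ≤ Fintype.card (Fin N) := by
      rw [Fintype.card_fin]
      exact hzi.card_le_finrank_succ.trans (Nat.succ_le_succ (Submodule.finrank_le _))
    obtain ⟨e⟩ := Function.Embedding.nonempty_of_card_le hcard
    refine ⟨(Function.extend e w 0, Function.extend e z fun _ => x₀), ⟨⟨fun i => ?_, ?_⟩,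
      fun i _ => ?_⟩, ?_⟩
    · by_cases hi : ∃ a, e a = i
      · obtain ⟨a, rfl⟩ := hi
        simpa [e.injective.extend_apply] using (hw a).le
      · simp [Function.extend_apply' _ _ _ hi]
    · rw [← hw1]
      refine (Fintype.sum_of_injective e e.injective _ _ (fun i hi => ?_) fun a => ?_).symm
      · exact Function.extend_apply' _ _ _ hi
      · simp [e.injective.extend_apply]
    · by_cases hi : ∃ a, e a = i
      · obtain ⟨a, rfl⟩ := hi
        simpa [e.injective.extend_apply] using hz (mem_range_self a)
      · simpa [Function.extend_apply' _ _ _ hi] using hx₀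
    · refine (Fintype.sum_of_injective e e.injective _ _ (fun i hi => ?_) fun a => ?_).symm
      · simp [Function.extend_apply' w _ _ hi]
      · simp [e.injective.extend_apply]
  · rintro ⟨⟨w, z⟩, ⟨hw, hz⟩, rfl⟩
    exact (convex_convexHull ℝ s).sum_mem (fun i _ => hw.1 i) hw.2
      fun i _ => subset_convexHull ℝ s (hz i (mem_univ i))

variable {E F : Type*} [NormedAddCommGroup E] [NormedSpace ℝ E]
  [NormedAddCommGroup F] [NormedSpace ℝ F]

/-- The derivatives of `g` at the points of differentiability in the ball of radius `r` at `p`. -/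
def derivNear (g : E → F) (p : E) (r : ℝ) : Set (E →L[ℝ] F) :=
  fderiv ℝ g '' {q | q ∈ ball p r ∧ DifferentiableAt ℝ g q}

theorem derivNear_mono (g : E → F) (p : E) {r r' : ℝ} (h : r ≤ r') :
    derivNear g p r ⊆ derivNear g p r' :=
  image_mono fun _ hq => ⟨ball_subset_ball h hq.1, hq.2⟩

theorem derivNear_subset_closedBall {g : E → F} {C : ℝ≥0} (hg : LipschitzWith C g) (p : E) (r : ℝ) :
    derivNear g p r ⊆ closedBall 0 C := by
  rintro _ ⟨q, -, rfl⟩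
  simpa using norm_fderiv_le_of_lipschitz ℝ hg

theorem closure_convexHull_derivNear_subset_closedBall {g : E → F} {C : ℝ≥0}
    (hg : LipschitzWith C g) (p : E) (r : ℝ) :
    closure (convexHull ℝ (derivNear g p r)) ⊆ closedBall 0 C :=
  closure_minimal (convexHull_min (derivNear_subset_closedBall hg p r) (convex_closedBall 0 _))
    isClosed_closedBall

theorem clarkeJacobian_congr {f g : E → F} {p : E} (h : f =ᶠ[𝓝 p] g) :
    clarkeJacobian f p ⊆ clarkeJacobian g p := by
  refine convexHull_mono ?_
  rintro A ⟨q, hq, hqp, hA⟩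
  have h1 : ∀ᶠ n in atTop, f =ᶠ[𝓝 (q n)] g := hqp.eventually h.eventually_nhds
  obtain ⟨N, hN⟩ := eventually_atTop.1 h1
  refine ⟨fun n => q (n + N), fun n => ?_, hqp.comp (tendsto_add_atTop_nat N), ?_⟩
  · exact (hN (n + N) (by omega)).differentiableAt_iff.1 (hq _)
  · refine (hA.comp (tendsto_add_atTop_nat N)).congr fun n => ?_
    exact (hN (n + N) (by omega)).fderiv_eq

variable [FiniteDimensional ℝ E] [FiniteDimensional ℝ F]

/-- The closures of `derivNear` at radii tending to zero are nested compact sets whose intersection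
is the set `S` of limiting derivatives. They eventually enter every neighbourhood of `convexHull ℝ
S`, which is convex compact; so closed convex hulls taken before the limit yield nothing new. -/
theorem mem_clarkeJacobian_of_forall_mem_closure {g : E → F} {C : ℝ≥0} (hg : LipschitzWith C g)
    {p : E} {A : E →L[ℝ] F}
    (hA : ∀ r > 0, A ∈ closure (convexHull ℝ (derivNear g p r))) : A ∈ clarkeJacobian g p := by
  have : ProperSpace (E →L[ℝ] F) := FiniteDimensional.proper_real _
  set V : ℕ → Set (E →L[ℝ] F) := fun n => closure (derivNear g p (1 / ((n : ℝ) + 1))) with hV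
  set S : Set (E →L[ℝ] F) := {A | ∃ q : ℕ → E, (∀ n, DifferentiableAt ℝ g (q n)) ∧
    Tendsto q atTop (𝓝 p) ∧ Tendsto (fun n => fderiv ℝ g (q n)) atTop (𝓝 A)} with hS
  have hVc : ∀ n, IsCompact (V n) := fun n =>
    (isCompact_closedBall (0 : E →L[ℝ] F) C).of_isClosed_subset isClosed_closure
      (closure_minimal (derivNear_subset_closedBall hg _ _) isClosed_closedBall)
  have hVanti : Antitone V := fun m n hmn =>
    closure_mono (derivNear_mono g p (Nat.one_div_le_one_div hmn))
  have hVS : ⋂ n, V n ⊆ S := by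
    intro B hB
    have h1 : ∀ n : ℕ, ∃ q, (q ∈ ball p (1 / ((n : ℝ) + 1)) ∧ DifferentiableAt ℝ g q) ∧
        dist (fderiv ℝ g q) B < 1 / ((n : ℝ) + 1) := by
      intro n
      obtain ⟨_, ⟨q, hq, rfl⟩, hd⟩ :=
        Metric.mem_closure_iff.1 (mem_iInter.1 hB n) _ (Nat.one_div_pos_of_nat (α := ℝ) (n := n))
      exact ⟨q, hq, by rwa [dist_comm]⟩
    choose q hq hd using h1
    refine ⟨q, fun n => (hq n).2, ?_, ?_⟩
    · exact tendsto_iff_dist_tendsto_zero.2 (squeeze_zero (fun _ => dist_nonneg)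
        (fun n => (mem_ball.1 (hq n).1).le) tendsto_one_div_add_atTop_nhds_zero_nat)
    · exact tendsto_iff_dist_tendsto_zero.2 (squeeze_zero (fun _ => dist_nonneg)
        (fun n => (hd n).le) tendsto_one_div_add_atTop_nhds_zero_nat)
  have hSV : S ⊆ ⋂ n, V n := by
    rintro B ⟨q, hq, hqp, hB⟩
    refine mem_iInter.2 fun n => mem_closure_of_tendsto hB ?_
    filter_upwards [hqp.eventually (ball_mem_nhds p (Nat.one_div_pos_of_nat (α := ℝ) (n := n)))]
      with k hk using ⟨q k, ⟨hk, hq k⟩, rfl⟩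
  have hSc : IsCompact S := by
    rw [hSV.antisymm hVS]
    exact (hVc 0).of_isClosed_subset (isClosed_iInter fun n => isClosed_closure)
      (iInter_subset V 0)
  have hcl : A ∈ closure (convexHull ℝ S) := by
    rw [closure_eq_iInter_cthickening]
    refine mem_iInter₂.2 fun δ hδ => ?_
    obtain ⟨n, hn⟩ := exists_subset_nhds_of_isCompact (V := V)
      (directed_of_isDirected_le fun m n h => hVanti h) hVc (U := thickening δ (convexHull ℝ S))
      fun B hB => (isOpen_thickening.mem_nhds
        (self_subset_thickening hδ _ (subset_convexHull ℝ S (hVS hB))))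
    have h1 : convexHull ℝ (derivNear g p (1 / ((n : ℝ) + 1))) ⊆ thickening δ (convexHull ℝ S) :=
      convexHull_min (subset_closure.trans hn) ((convex_convexHull ℝ S).thickening δ)
    exact closure_thickening_subset_cthickening _ _
      (closure_mono h1 (hA _ (Nat.one_div_pos_of_nat (α := ℝ) (n := n))))
  rwa [(isCompact_convexHull_of_isCompact hSc).isClosed.closure_eq] at hcl

/-- A Lipschitz map is approximated by everywhere differentiable maps, whose derivatives are limits
of convex combinations of derivatives at nearby points. -/
theorem exists_differentiable_approx {g : E → F} {C : ℝ≥0} (hg : LipschitzWith C g) {s : ℝ}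
    (hs : 0 < s) :
    ∃ f : E → F, Differentiable ℝ f ∧ (∀ x, ‖f x - g x‖ ≤ C * s) ∧
      ∀ p r x, dist x p + s ≤ r →
        fderiv ℝ f x ∈ closure (convexHull ℝ (derivNear g p r)) := by
  borelize E
  let μ : Measure E := Measure.addHaar
  have hμ0 : μ (ball 0 1) ≠ 0 := (measure_ball_pos μ 0 one_pos).ne'
  have hμt : μ (ball 0 1) ≠ ⊤ := measure_ball_lt_top.ne
  -- `ν` is the uniform probability on the unit ball, and the approximation is `x ↦ ∫ g (x + s z)
  -- dν(z)`. No smooth kernel is needed: for each `x`, `g` is differentiable at `x + s z` for almost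
  -- every `z`, and the Lipschitz bound allows differentiation under the integral.
  let ν : Measure E := ProbabilityTheory.cond μ (ball 0 1)
  have hν : IsProbabilityMeasure ν :=
    ProbabilityTheory.cond_isProbabilityMeasure_of_finite hμ0 hμt
  have hνμ : ν ≪ μ := ProbabilityTheory.cond_absolutelyContinuous
  have hνb : ∀ᵐ z ∂ν, z ∈ ball (0 : E) 1 := ProbabilityTheory.ae_cond_mem measurableSet_ball
  have hcont : ∀ x, Continuous fun z => g (x + s • z) := fun x =>
    hg.continuous.comp (by fun_prop)
  have hclose : ∀ x, ∀ᵐ z ∂ν, ‖g (x + s • z) - g x‖ ≤ C * s := by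
    intro x
    filter_upwards [hνb] with z hz
    rw [← dist_eq_norm]
    refine (hg.dist_le_mul _ _).trans (mul_le_mul_of_nonneg_left ?_ C.2)
    rw [dist_eq_norm, add_sub_cancel_left, norm_smul, Real.norm_eq_abs, abs_of_pos hs]
    rw [mem_ball_zero_iff] at hz
    nlinarith
  have hint : ∀ x, Integrable (fun z => g (x + s • z)) ν := by
    intro x
    have h1 : Integrable (fun z => g (x + s • z) - g x) ν :=
      Integrable.of_bound ((hcont x).sub continuous_const).aestronglyMeasurable _ (hclose x)
    exact (h1.add (integrable_const (g x))).congr (Eventually.of_forall fun z => by simp)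
  have hdiff : ∀ x, ∀ᵐ z ∂ν, DifferentiableAt ℝ g (x + s • z) := by
    intro x
    refine hνμ.ae_le ?_
    have h1 : Measure.QuasiMeasurePreserving (fun z : E => x + s • z) μ μ := by
      refine (measurePreserving_add_left μ x).quasiMeasurePreserving.comp ?_
      exact Measure.quasiMeasurePreserving_smul μ hs.ne'
    exact h1.ae (hg.ae_differentiableAt (μ := μ))
  have hder : ∀ x, Integrable (fun z => fderiv ℝ g (x + s • z)) ν ∧
      HasFDerivAt (fun x => ∫ z, g (x + s • z) ∂ν) (∫ z, fderiv ℝ g (x + s • z) ∂ν) x := by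
    intro x
    refine hasFDerivAt_integral_of_dominated_loc_of_lip (s := univ) (bound := fun _ => (C : ℝ))
      univ_mem (Eventually.of_forall fun y => (hcont y).aestronglyMeasurable) (hint x) ?_ ?_
      (integrable_const _) ?_
    · exact ((measurable_fderiv ℝ g).comp (by fun_prop)).aestronglyMeasurable
    · refine Eventually.of_forall fun z => LipschitzWith.lipschitzOnWith ?_
      have : Real.nnabs (C : ℝ) = C := by simp
      rw [this]
      exact LipschitzWith.of_dist_le_mul fun a b => by
        simpa using hg.dist_le_mul (a + s • z) (b + s • z)
    · filter_upwards [hdiff x] with z hz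
      exact (hasFDerivAt_comp_add_right (s • z)).2 hz.hasFDerivAt
  refine ⟨fun x => ∫ z, g (x + s • z) ∂ν, fun x => (hder x).2.differentiableAt, fun x => ?_,
    fun p r x hx => ?_⟩
  · have h1 : (∫ z, g (x + s • z) ∂ν) - g x = ∫ z, (g (x + s • z) - g x) ∂ν := by
      rw [integral_sub (hint x) (integrable_const _)]
      simp
    rw [h1]
    simpa using norm_integral_le_of_norm_le_const (hclose x)
  · rw [(hder x).2.fderiv]
    refine (convex_convexHull ℝ _).closure.integral_mem isClosed_closure ?_ (hder x).1
    filter_upwards [hdiff x, hνb] with z hz hzb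
    refine subset_closure (subset_convexHull ℝ _ ⟨_, ⟨?_, hz⟩, rfl⟩)
    rw [mem_ball_zero_iff] at hzb
    rw [mem_ball]
    have h1 : dist (x + s • z) x < s := by
      rw [dist_eq_norm, add_sub_cancel_left, norm_smul, Real.norm_eq_abs, abs_of_pos hs]
      nlinarith
    linarith [dist_triangle (x + s • z) x p]

end Clarke

/-! ### Realizing a derivative along a linear map by an element of the generalized Jacobian. -/

section ClarkeChain

open Metric

/-- A smooth probability density on a finite-dimensional space, supported in the unit ball. -/
theorem exists_smooth_density (T : Type*) [NormedAddCommGroup T] [NormedSpace ℝ T]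
    [FiniteDimensional ℝ T] [MeasurableSpace T] [BorelSpace T] (μ : Measure T)
    [μ.IsAddHaarMeasure] :
    ∃ η : T → ℝ, ContDiff ℝ 1 η ∧ HasCompactSupport η ∧ (∀ w, 0 ≤ η w) ∧ ∫ w, η w ∂μ = 1 ∧
      ∀ w, η w ≠ 0 → ‖w‖ ≤ 1 := by
  let b : ContDiffBump (0 : T) := ⟨1 / 2, 1, by norm_num, by norm_num⟩
  refine ⟨b.normed μ, b.contDiff_normed, b.hasCompactSupport_normed, b.nonneg_normed,
    b.integral_normed, fun w hw => ?_⟩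
  have h : w ∈ Function.support (b.normed μ) := hw
  rw [b.support_normed_eq, mem_ball_zero_iff] at h
  exact h.le

/-- A weighted mean of a bounded map with values in a closed convex set stays in the set. -/
theorem integral_smul_mem_of_density {V : Type*} [NormedAddCommGroup V] [NormedSpace ℝ V]
    [CompleteSpace V] {T : Type*} [MeasurableSpace T] (μ : Measure T) {η : T → ℝ}
    (hη : Measurable η) (hη0 : ∀ w, 0 ≤ η w) (hηi : Integrable η μ) (hη1 : ∫ w, η w ∂μ = 1)
    {S : Set V} (hS : Convex ℝ S) (hSc : IsClosed S) {A : T → V}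
    (hA : ∀ w, η w ≠ 0 → A w ∈ S) (hAi : Integrable (fun w => η w • A w) μ) :
    ∫ w, η w • A w ∂μ ∈ S := by
  let ρ : T → ℝ≥0 := fun w => (η w).toNNReal
  have hρ : Measurable ρ := hη.real_toNNReal
  have hρη : ∀ w, (ρ w : ℝ) = η w := fun w => Real.coe_toNNReal _ (hη0 w)
  let ν : Measure T := μ.withDensity fun w => (ρ w : ENNReal)
  have hν : IsProbabilityMeasure ν := ⟨by
    rw [withDensity_apply _ MeasurableSet.univ, Measure.restrict_univ]
    have : ∀ w, (ρ w : ENNReal) = ENNReal.ofReal (η w) := fun w => rfl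
    simp only [this]
    rw [← ofReal_integral_eq_lintegral_ofReal hηi (Eventually.of_forall hη0), hη1,
      ENNReal.ofReal_one]⟩
  have hsm : ∀ w, ρ w • A w = η w • A w := fun w => by rw [NNReal.smul_def, hρη]
  have e : ∫ w, η w • A w ∂μ = ∫ w, A w ∂ν := by
    rw [integral_withDensity_eq_integral_smul hρ]
    simp only [hsm]
  rw [e]
  refine hS.integral_mem hSc ?_ ?_
  · rw [ae_withDensity_iff (by fun_prop)]
    refine Eventually.of_forall fun w hw => hA w fun h => hw ?_
    have : ρ w = 0 := by simp [ρ, h]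
    simp [this]
  · rw [integrable_withDensity_iff_integrable_smul hρ]
    simpa only [hsm] using hAi

variable {T F : Type*} [NormedAddCommGroup T] [NormedSpace ℝ T]
  [FiniteDimensional ℝ T] [NormedAddCommGroup F] [NormedSpace ℝ F] [FiniteDimensional ℝ F]

/-- The mean derivative of a map uniformly close to an affine map is close to its linear part. -/
theorem norm_integral_smul_fderiv_sub_le [MeasurableSpace T] [BorelSpace T] (μ : Measure T)
    [μ.IsAddHaarMeasure] {η : T → ℝ} (hη : ContDiff ℝ 1 η) (hηc : HasCompactSupport η)
    (hη1 : ∫ w, η w ∂μ = 1) (hηb : ∀ w, η w ≠ 0 → ‖w‖ ≤ 1) {h : T → F} (hh : Differentiable ℝ h)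
    {M ε : ℝ} (hM : ∀ w, ‖fderiv ℝ h w‖ ≤ M) (c : F) (B : T →L[ℝ] F)
    (hε : ∀ w, ‖w‖ ≤ 1 → ‖h w - (c + B w)‖ ≤ ε) (hε0 : 0 ≤ ε) :
    Integrable (fun w => η w • fderiv ℝ h w) μ ∧
      ‖∫ w, η w • fderiv ℝ h w ∂μ - B‖ ≤ ε * ∫ w, ‖fderiv ℝ η w‖ ∂μ := by
  have hηi : Integrable η μ := hη.continuous.integrable_of_hasCompactSupport hηc
  have hη'c : Continuous (fderiv ℝ η) := hη.continuous_fderiv one_ne_zero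
  have hη's : HasCompactSupport (fderiv ℝ η) := hηc.fderiv (𝕜 := ℝ)
  have hη'i : Integrable (fun w => ‖fderiv ℝ η w‖) μ :=
    (hη'c.integrable_of_hasCompactSupport hη's).norm
  have hi : Integrable (fun w => η w • fderiv ℝ h w) μ :=
    hηi.smul_of_top_left (memLp_top_of_bound (measurable_fderiv ℝ h).aestronglyMeasurable M
      (Eventually.of_forall hM))
  refine ⟨hi, ContinuousLinearMap.opNorm_le_bound _ (by positivity) fun v => ?_⟩
  set k : T → F := fun w => h w - (c + B w) with hk
  have hk' : ∀ w, HasFDerivAt k (fderiv ℝ h w - B) w := fun w =>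
    (hh w).hasFDerivAt.sub (B.hasFDerivAt.const_add c)
  have hkc : Continuous k := continuous_iff_continuousAt.2 fun w => (hk' w).continuousAt
  have hi2 : Integrable (fun w => η w • (fderiv ℝ h w - B)) μ := by
    simp only [smul_sub]
    exact hi.sub (hηi.smul_const B)
  have e1 : ∫ w, η w • fderiv ℝ h w ∂μ - B = ∫ w, η w • (fderiv ℝ h w - B) ∂μ := by
    simp only [smul_sub]
    rw [integral_sub hi (hηi.smul_const B), integral_smul_const, hη1, one_smul]
  have hib : Integrable (fun w => fderiv ℝ η w v • k w) μ :=
    ((hη'c.clm_apply continuous_const).smul hkc).integrable_of_hasCompactSupport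
      ((hηc.fderiv_apply (𝕜 := ℝ) v).smul_right)
  -- The deviation `k` from the affine map is small but its derivative need not be; integration by
  -- parts moves the derivative onto `η`.
  have hibp := integral_smul_fderiv_eq_neg_fderiv_smul_of_integrable (μ := μ) (f := η) (g := k)
    (v := v) hib
    (by simpa [(hk' _).fderiv] using hi2.apply_continuousLinearMap v)
    ((hη.continuous.smul hkc).integrable_of_hasCompactSupport hηc.smul_right)
    (fun w _ => hη.differentiable one_ne_zero w) (fun w _ => (hk' w).differentiableAt)
  have e2 : (∫ w, η w • (fderiv ℝ h w - B) ∂μ) v = - ∫ w, fderiv ℝ η w v • k w ∂μ := by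
    rw [← hibp, ContinuousLinearMap.integral_apply hi2]
    simp [(hk' _).fderiv]
  rw [e1, e2, norm_neg]
  have hsupp : ∀ w, fderiv ℝ η w ≠ 0 → ‖w‖ ≤ 1 := by
    intro w hw
    have h1 : w ∈ tsupport η := tsupport_fderiv_subset ℝ (subset_tsupport _ hw)
    have h2 : tsupport η ⊆ closedBall 0 1 :=
      closure_minimal (fun x hx => by simpa using hηb x hx) isClosed_closedBall
    simpa using h2 h1
  calc ‖∫ w, fderiv ℝ η w v • k w ∂μ‖ ≤ ∫ w, ‖fderiv ℝ η w‖ * (ε * ‖v‖) ∂μ := by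
        refine norm_integral_le_of_norm_le (hη'i.mul_const _) (Eventually.of_forall fun w => ?_)
        by_cases hw : fderiv ℝ η w = 0
        · simp [hw]
        · rw [norm_smul]
          calc ‖fderiv ℝ η w v‖ * ‖k w‖ ≤ (‖fderiv ℝ η w‖ * ‖v‖) * ε :=
                mul_le_mul (ContinuousLinearMap.le_opNorm _ _) (hε w (hsupp w hw))
                  (norm_nonneg _) (by positivity)
            _ = _ := by ring
    _ = ε * (∫ w, ‖fderiv ℝ η w‖ ∂μ) * ‖v‖ := by rw [integral_mul_const]; ring

variable {E : Type*} [NormedAddCommGroup E] [NormedSpace ℝ E] [FiniteDimensional ℝ E]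

/-- `A` is a weighted mean of derivatives of a smoothed `g` at the points `p + t D w`, `‖w‖ ≤ 1`.
The blow-up `w ↦ t⁻¹ f (p + t D w)` of the smoothed map `f` is uniformly close to an affine map with
linear part `B`, so its mean derivative `A ∘ D` is close to `B`. -/
theorem exists_mem_closure_convexHull_norm_comp_sub_le {g : E → F} {C : ℝ≥0}
    (hg : LipschitzWith C g) {p : E} {D : T →L[ℝ] E} {B : T →L[ℝ] F}
    (hB : HasFDerivAt (fun w => g (p + D w)) B 0) {r ε : ℝ} (hr : 0 < r) (hε : 0 < ε) :
    ∃ A ∈ closure (convexHull ℝ (derivNear g p r)), ‖A.comp D - B‖ ≤ ε := by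
  borelize T
  borelize E
  let μ : Measure T := Measure.addHaar
  obtain ⟨η, hη, hηc, hη0, hη1, hηb⟩ := exists_smooth_density T μ
  set I := ∫ w, ‖fderiv ℝ η w‖ ∂μ with hI
  have hI0 : 0 ≤ I := integral_nonneg fun _ => norm_nonneg _
  -- The blow-up has error at most `2 δ`, half from smoothing and half from differentiability, and
  -- the mean derivative then has error at most `2 δ I ≤ ε`.
  set δ := ε / (2 * (I + 1)) with hδ
  have hδ0 : 0 < δ := by positivity
  have hsmall : ∀ᶠ w in 𝓝 (0 : T), ‖g (p + D w) - g p - B w‖ ≤ δ * ‖w‖ := by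
    have := hB.isLittleO.def hδ0
    simpa using this
  obtain ⟨ρ, hρ, hρs⟩ := Metric.eventually_nhds_iff.1 hsmall
  obtain ⟨t, ht0, ht1, htr, htρ, htC⟩ : ∃ t : ℝ, 0 < t ∧ t ≤ 1 ∧ t * (‖D‖ + 1) ≤ r ∧ t < ρ ∧
      C * t ≤ δ := by
    have h1 : ∀ᶠ t : ℝ in 𝓝[>] 0, t * (‖D‖ + 1) < r := by
      have : Continuous fun t : ℝ => t * (‖D‖ + 1) := by fun_prop
      exact ((this.tendsto' 0 0 (by simp)).mono_left nhdsWithin_le_nhds).eventually_lt_const hr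
    have h2 : ∀ᶠ t : ℝ in 𝓝[>] 0, C * t < δ := by
      have : Continuous fun t : ℝ => C * t := by fun_prop
      exact ((this.tendsto' 0 0 (by simp)).mono_left nhdsWithin_le_nhds).eventually_lt_const hδ0
    obtain ⟨t, ⟨⟨h1, h2⟩, h3⟩, h4⟩ := ((h1.and h2).and (Ioo_mem_nhdsGT hρ)).and
      (Ioo_mem_nhdsGT one_pos) |>.exists
    exact ⟨t, h4.1, h4.2.le, h1.le, h3.2, h2.le⟩
  -- The smoothing scale is `t²`, so that the error `C t²` is still only `C t ≤ δ` after division by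
  -- `t`. The points used stay within `t ‖D‖ + t² ≤ r` of `p`.
  obtain ⟨f, hf, hfg, hfm⟩ := exists_differentiable_approx hg (s := t ^ 2) (by positivity)
  set h : T → F := fun w => t⁻¹ • f (p + t • D w) with hh
  have hh' : ∀ w, HasFDerivAt h ((fderiv ℝ f (p + t • D w)).comp D) w := by
    intro w
    have h1 : HasFDerivAt (fun w => p + t • D w) (t • D) w :=
      (D.hasFDerivAt.const_smul t).const_add p
    have h2 := ((hf (p + t • D w)).hasFDerivAt.comp w h1).const_smul t⁻¹
    rwa [ContinuousLinearMap.comp_smul, smul_smul, inv_mul_cancel₀ ht0.ne', one_smul] at h2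
  have hfC : ∀ x, ‖fderiv ℝ f x‖ ≤ C := by
    intro x
    have := closure_convexHull_derivNear_subset_closedBall hg x (t ^ 2)
      (hfm x _ x (by simp))
    simpa using this
  have hM : ∀ w, ‖fderiv ℝ h w‖ ≤ C * ‖D‖ := by
    intro w
    rw [(hh' w).fderiv]
    exact (ContinuousLinearMap.opNorm_comp_le _ _).trans
      (mul_le_mul_of_nonneg_right (hfC _) (norm_nonneg _))
  have hclose : ∀ w, ‖w‖ ≤ 1 → ‖h w - (t⁻¹ • g p + B w)‖ ≤ 2 * δ := by
    intro w hw
    have e : h w - (t⁻¹ • g p + B w) = t⁻¹ • (f (p + t • D w) - g (p + t • D w)) +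
        t⁻¹ • (g (p + D (t • w)) - g p - B (t • w)) := by
      rw [hh, map_smul, map_smul]
      simp only [smul_sub, smul_smul, inv_mul_cancel₀ ht0.ne', one_smul]
      abel
    have hti : 0 < t⁻¹ := inv_pos.2 ht0
    have h1 : ‖t • w‖ ≤ t := by
      rw [norm_smul, Real.norm_eq_abs, abs_of_pos ht0]
      nlinarith
    have h2 := hρs (y := t • w) (by rw [dist_zero_right]; linarith)
    have h3 := hfg (p + t • D w)
    rw [e]
    refine (norm_add_le _ _).trans ?_
    rw [norm_smul, norm_smul, Real.norm_eq_abs, abs_of_pos hti]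
    have h4 : t⁻¹ * ‖f (p + t • D w) - g (p + t • D w)‖ ≤ C * t := by
      rw [inv_mul_le_iff₀ ht0]
      nlinarith
    have h5 : t⁻¹ * ‖g (p + D (t • w)) - g p - B (t • w)‖ ≤ δ := by
      rw [inv_mul_le_iff₀ ht0]
      nlinarith
    linarith
  obtain ⟨hi, hle⟩ := norm_integral_smul_fderiv_sub_le μ hη hηc hη1 hηb
    (fun w => (hh' w).differentiableAt) hM (t⁻¹ • g p) B hclose (by positivity)
  have hηi : Integrable η μ := hη.continuous.integrable_of_hasCompactSupport hηc
  have hAi : Integrable (fun w => η w • fderiv ℝ f (p + t • D w)) μ := by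
    have hm : Measurable fun w : T => p + t • D w := by fun_prop
    exact hηi.smul_of_top_left (memLp_top_of_bound
      ((measurable_fderiv ℝ f).comp hm).aestronglyMeasurable C
      (Eventually.of_forall fun w => hfC _))
  refine ⟨∫ w, η w • fderiv ℝ f (p + t • D w) ∂μ, ?_, ?_⟩
  · refine integral_smul_mem_of_density μ hη.continuous.measurable hη0 hηi hη1
      (convex_convexHull ℝ _).closure isClosed_closure (fun w hw => hfm p r _ ?_) hAi
    have h1 : ‖t • D w‖ ≤ t * ‖D‖ := by
      rw [norm_smul, Real.norm_eq_abs, abs_of_pos ht0]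
      refine mul_le_mul_of_nonneg_left ((D.le_opNorm w).trans ?_) ht0.le
      exact mul_le_of_le_one_right (norm_nonneg _) (hηb w hw)
    rw [dist_eq_norm, add_sub_cancel_left]
    nlinarith
  · have e : (∫ w, η w • fderiv ℝ f (p + t • D w) ∂μ).comp D = ∫ w, η w • fderiv ℝ h w ∂μ := by
      have := ((ContinuousLinearMap.compL ℝ T E F).flip D).integral_comp_comm hAi
      simpa [(hh' _).fderiv] using this.symm
    rw [e]
    refine hle.trans ?_
    rw [hδ]
    have : 2 * (ε / (2 * (I + 1))) * I = ε * (I / (I + 1)) := by field_simp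
    rw [← hI, this]
    exact mul_le_of_le_one_right hε.le ((div_le_one (by positivity)).2 (by linarith))

/-- If a Lipschitz map `g` has derivative `B` at `p` along the linear map `D`, then some element of
Clarke's generalized Jacobian of `g` at `p` restricts to `B` along `D`. -/
theorem exists_mem_clarkeJacobian_comp_eq {g : E → F} {C : ℝ≥0}
    (hg : LipschitzWith C g) {p : E} {D : T →L[ℝ] E} {B : T →L[ℝ] F}
    (hB : HasFDerivAt (fun w => g (p + D w)) B 0) :
    ∃ A ∈ clarkeJacobian g p, A.comp D = B := by
  have : ProperSpace (E →L[ℝ] F) := FiniteDimensional.proper_real _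
  have h1 : ∀ n : ℕ, ∃ A ∈ closure (convexHull ℝ (derivNear g p (1 / ((n : ℝ) + 1)))),
      ‖A.comp D - B‖ ≤ 1 / ((n : ℝ) + 1) := fun n =>
    exists_mem_closure_convexHull_norm_comp_sub_le hg hB Nat.one_div_pos_of_nat
      Nat.one_div_pos_of_nat
  choose A hA hAB using h1
  obtain ⟨A', -, k, hk, hlim⟩ := (isCompact_closedBall (0 : E →L[ℝ] F) C).tendsto_subseq
    fun n => closure_convexHull_derivNear_subset_closedBall hg _ _ (hA n)
  refine ⟨A', mem_clarkeJacobian_of_forall_mem_closure hg fun r hr => ?_, ?_⟩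
  · obtain ⟨N, hN⟩ := exists_nat_one_div_lt hr
    refine isClosed_closure.mem_of_tendsto hlim ?_
    filter_upwards [eventually_ge_atTop N] with n hn
    refine closure_mono (convexHull_mono (derivNear_mono g p ?_)) (hA (k n))
    exact (Nat.one_div_le_one_div (hn.trans (hk.id_le n))).trans hN.le
  · have h2 : Tendsto (fun n => ‖(A (k n)).comp D - B‖) atTop (𝓝 ‖A'.comp D - B‖) := by
      have hc : Continuous fun A : E →L[ℝ] F => ‖A.comp D - B‖ := by fun_prop
      exact (hc.tendsto A').comp hlim
    have h3 : Tendsto (fun n => ‖(A (k n)).comp D - B‖) atTop (𝓝 0) :=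
      squeeze_zero (fun _ => norm_nonneg _) (fun n => hAB (k n))
        (tendsto_one_div_add_atTop_nhds_zero_nat.comp hk.tendsto_atTop)
    exact sub_eq_zero.1 (norm_eq_zero.1 (tendsto_nhds_unique h2 h3))

end ClarkeChain

/-! ### The chain rule along Lipschitz graphs and the choice of the Jacobian. -/

section ChainRule

/-- Along a curve `γ` differentiable at `θ`, a Lipschitz map has the same derivative as along the
tangent map of `γ`. -/
theorem hasFDerivAt_comp_tangent {T E F : Type*} [NormedAddCommGroup T] [NormedSpace ℝ T]
    [NormedAddCommGroup E] [NormedSpace ℝ E] [NormedAddCommGroup F] [NormedSpace ℝ F]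
    {g : E → F} {C : ℝ≥0} (hg : LipschitzWith C g) {γ : T → E} {θ : T} {D : T →L[ℝ] E}
    {B : T →L[ℝ] F} (hγ : HasFDerivAt γ D θ) (hB : HasFDerivAt (fun w => g (γ w)) B θ) :
    HasFDerivAt (fun w => g (γ θ + D w)) B 0 := by
  rw [hasFDerivAt_iff_isLittleO_nhds_zero] at hγ hB ⊢
  -- Replacing the curve by its tangent costs at most `C` times the first-order remainder of `γ`,
  -- which is `o(w)`.
  have h1 : (fun w => g (γ (θ + w)) - g (γ θ + D w)) =O[𝓝 0]
      fun w => γ (θ + w) - γ θ - D w := by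
    refine Asymptotics.IsBigO.of_bound C (Eventually.of_forall fun w => ?_)
    rw [sub_sub, ← dist_eq_norm, ← dist_eq_norm]
    exact hg.dist_le_mul _ _
  refine (hB.sub (h1.trans_isLittleO hγ)).congr_left fun w => ?_
  simp
  abel

theorem fderiv_mem_clarkeJacobian {E F : Type*} [NormedAddCommGroup E] [NormedSpace ℝ E]
    [NormedAddCommGroup F] [NormedSpace ℝ F] {f : E → F} {p : E} (h : DifferentiableAt ℝ f p) :
    fderiv ℝ f p ∈ clarkeJacobian f p :=
  subset_convexHull ℝ _ ⟨fun _ => p, fun _ => h, tendsto_const_nhds, tendsto_const_nhds⟩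

variable {E T F : Type*} [NormedAddCommGroup E] [NormedSpace ℝ E] [FiniteDimensional ℝ E]
  [NormedAddCommGroup T] [NormedSpace ℝ T] [FiniteDimensional ℝ T]
  [NormedAddCommGroup F] [NormedSpace ℝ F] [FiniteDimensional ℝ F]

theorem exists_mem_clarkeJacobian_comp_eq_of_lipschitzOnWith {f : E → F} {Ω : Set E} {L : ℝ≥0}
    (hΩ : IsOpen Ω) (hf : LipschitzOnWith L f Ω) {γ : T → E} {θ : T} (hθ : γ θ ∈ Ω)
    {D : T →L[ℝ] E} {B : T →L[ℝ] F} (hγ : HasFDerivAt γ D θ)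
    (hB : HasFDerivAt (fun w => f (γ w)) B θ) :
    ∃ A ∈ clarkeJacobian f (γ θ), A.comp D = B := by
  obtain ⟨g, hg, hfg⟩ := hf.extend_finite_dimension
  have hev : f =ᶠ[𝓝 (γ θ)] g := hfg.eventuallyEq_of_mem (hΩ.mem_nhds hθ)
  have hB' : HasFDerivAt (fun w => g (γ w)) B θ :=
    hB.congr_of_eventuallyEq (hγ.continuousAt.eventually hev.symm)
  obtain ⟨A, hA, hAD⟩ := exists_mem_clarkeJacobian_comp_eq hg (hasFDerivAt_comp_tangent hg hγ hB')
  exact ⟨A, clarkeJacobian_congr hev.symm hA, hAD⟩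

/-- A constant curve has derivative zero, as does its image, so the existence result along curves
applies. -/
theorem clarkeJacobian_nonempty {f : E → F} {Ω : Set E} {L : ℝ≥0} (hΩ : IsOpen Ω)
    (hf : LipschitzOnWith L f Ω) {p : E} (hp : p ∈ Ω) : (clarkeJacobian f p).Nonempty := by
  obtain ⟨A, hA, -⟩ := exists_mem_clarkeJacobian_comp_eq_of_lipschitzOnWith (T := ℝ)
    (γ := fun _ => p) (θ := 0) hΩ hf hp (hasFDerivAt_const p 0) (hasFDerivAt_const (f p) 0)
  exact ⟨A, hA⟩

/-- Almost everywhere on the coincidence set of two maps, their derivatives agree. -/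
theorem ae_fderiv_eq_of_eq {E : Type*} [NormedAddCommGroup E] [MeasurableSpace T] [BorelSpace T]
    (μ : Measure T) [μ.IsAddHaarMeasure] {Θ : Set T} (hΘ : IsOpen Θ) {c c' : T → E} {L L' : ℝ≥0}
    (hc : LipschitzOnWith L c Θ)
    (hc' : LipschitzOnWith L' c' Θ) {k k' : T → F} (hk : ∀ θ ∈ Θ, c θ = c' θ → k θ = k' θ) :
    ∀ᵐ θ ∂(μ.restrict Θ), c θ = c' θ → DifferentiableAt ℝ k θ → DifferentiableAt ℝ k' θ →
      fderiv ℝ k θ = fderiv ℝ k' θ := by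
  -- The curves are continuous only on `Θ`, so the coincidence set is written as `Θ` minus a
  -- relatively open subset to make its measurability visible.
  set S : Set T := Θ \ (Θ ∩ (fun θ => c θ - c' θ) ⁻¹' {0}ᶜ) with hS
  have hmem : ∀ θ, θ ∈ S ↔ θ ∈ Θ ∧ c θ = c' θ := by
    intro θ
    simp only [hS, Set.mem_sdiff, mem_inter_iff, mem_preimage, mem_compl_iff, mem_singleton_iff,
      sub_eq_zero]
    tauto
  have hSm : MeasurableSet S := hΘ.measurableSet.diff
    ((hc.continuousOn.sub hc'.continuousOn).isOpen_inter_preimage hΘ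
      isOpen_compl_singleton).measurableSet
  have h := ae_fderiv_eq_of_eqOn (f := k) (g := k') μ hSm
    fun θ hθ => hk θ ((hmem θ).1 hθ).1 ((hmem θ).1 hθ).2
  rw [ae_restrict_iff' hSm] at h
  rw [ae_restrict_iff' hΘ.measurableSet]
  filter_upwards [h] with θ hθ hθΘ hcc using hθ ((hmem θ).2 ⟨hθΘ, hcc⟩)

variable [MeasureSpace E] [BorelSpace E] [(volume : Measure E).IsAddHaarMeasure]
  [MeasureSpace T] [BorelSpace T] [(volume : Measure T).IsAddHaarMeasure]

/-- A Lipschitz map in a variable and a parameter has a version of its Jacobian for which the chain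
rule holds along countably many given Lipschitz graphs. -/
theorem exists_isJacobianVersion_chain {f : E × T → F} {Θ : Set T} (hΘ : IsOpen Θ) {L : ℝ≥0}
    (hf : LipschitzOnWith L f (univ ×ˢ Θ)) (c : ℕ → T → E)
    (hc : ∀ n, ∃ M : ℝ≥0, LipschitzOnWith M (c n) Θ) :
    ∃ J : E × T → E × T →L[ℝ] F, IsJacobianVersion f (univ ×ˢ Θ) J ∧
      ∀ n, ∀ᵐ θ ∂(volume.restrict Θ), fderiv ℝ (fun θ => f (c n θ, θ)) θ =
        (varBlock (J (c n θ, θ))).comp (fderiv ℝ (c n) θ) + paramBlock (J (c n θ, θ)) := by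
  classical
  have hΩ : IsOpen ((univ : Set E) ×ˢ Θ) := isOpen_univ.prod hΘ
  let D : ℕ → T → T →L[ℝ] E × T := fun n θ => (fderiv ℝ (c n) θ).prod (ContinuousLinearMap.id ℝ T)
  let B : ℕ → T → T →L[ℝ] F := fun n θ => fderiv ℝ (fun θ => f (c n θ, θ)) θ
  -- A good value at `p` satisfies the chain rule for every curve of the family whose graph passes
  -- through `p`, since `J p` cannot depend on `n`.
  let good : E × T → Set (E × T →L[ℝ] F) := fun p =>
    {A | A ∈ clarkeJacobian f p ∧ ∀ n, c n p.2 = p.1 → A.comp (D n p.2) = B n p.2}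
  have hJ : ∀ p : E × T, ∃ A : E × T →L[ℝ] F,
      (DifferentiableAt ℝ f p → A = fderiv ℝ f p) ∧
      (p ∈ (univ : Set E) ×ˢ Θ → A ∈ clarkeJacobian f p) ∧
      (¬ DifferentiableAt ℝ f p → (good p).Nonempty → A ∈ good p) := by
    intro p
    by_cases h1 : DifferentiableAt ℝ f p
    · exact ⟨_, fun _ => rfl, fun _ => fderiv_mem_clarkeJacobian h1, fun h => absurd h1 h⟩
    by_cases h2 : (good p).Nonempty
    · obtain ⟨A, hA⟩ := h2
      exact ⟨A, fun h => absurd h h1, fun _ => hA.1, fun _ _ => hA⟩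
    by_cases h3 : p ∈ (univ : Set E) ×ˢ Θ
    · obtain ⟨A, hA⟩ := clarkeJacobian_nonempty hΩ hf h3
      exact ⟨A, fun h => absurd h h1, fun _ => hA, fun _ h => absurd h h2⟩
    · exact ⟨0, fun h => absurd h h1, fun h => absurd h h3, fun _ h => absurd h h2⟩
  choose J hJd hJc hJg using hJ
  have hvol : (volume : Measure (E × T)).IsAddHaarMeasure :=
    inferInstanceAs (((volume : Measure E).prod (volume : Measure T)).IsAddHaarMeasure)
  refine ⟨J, ⟨?_, fun p _ hp => hJd p hp, hJc⟩, fun n => ?_⟩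
  · refine isWeakJacobian_of_lipschitzOnWith hΩ hf ?_
    filter_upwards [ae_differentiableAt_of_lipschitzOnWith volume hΩ hf] with p hp using hJd p hp
  have hk : ∀ m, ∃ M : ℝ≥0, LipschitzOnWith M (fun θ => f (c m θ, θ)) Θ := by
    intro m
    obtain ⟨M, hM⟩ := hc m
    exact ⟨_, hf.comp (hM.prodMk LipschitzWith.id.lipschitzOnWith) fun θ hθ => ⟨mem_univ _, hθ⟩⟩
  have hcd : ∀ m, ∀ᵐ θ ∂(volume.restrict Θ), DifferentiableAt ℝ (c m) θ := fun m =>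
    ae_differentiableAt_of_lipschitzOnWith volume hΘ (hc m).choose_spec
  have hkd : ∀ m, ∀ᵐ θ ∂(volume.restrict Θ), DifferentiableAt ℝ (fun θ => f (c m θ, θ)) θ :=
    fun m => ae_differentiableAt_of_lipschitzOnWith volume hΘ (hk m).choose_spec
  have hce : ∀ m, ∀ᵐ θ ∂(volume.restrict Θ), c m θ = c n θ → DifferentiableAt ℝ (c m) θ →
      DifferentiableAt ℝ (c n) θ → fderiv ℝ (c m) θ = fderiv ℝ (c n) θ := fun m =>
    ae_fderiv_eq_of_eq volume hΘ (hc m).choose_spec (hc n).choose_spec fun _ _ h => h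
  have hke : ∀ m, ∀ᵐ θ ∂(volume.restrict Θ), c m θ = c n θ →
      DifferentiableAt ℝ (fun θ => f (c m θ, θ)) θ →
      DifferentiableAt ℝ (fun θ => f (c n θ, θ)) θ → B m θ = B n θ := fun m =>
    ae_fderiv_eq_of_eq volume hΘ (hc m).choose_spec (hc n).choose_spec fun _ _ h => by
      simp only [h]
  rw [← ae_all_iff] at hcd hkd hce hke
  filter_upwards [hcd, hkd, hce, hke, ae_restrict_mem hΘ.measurableSet] with θ h1 h2 h3 h4 hθ
  have hγ : HasFDerivAt (fun θ => (c n θ, θ)) (D n θ) θ :=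
    (h1 n).hasFDerivAt.prodMk (hasFDerivAt_id θ)
  have hsplit : ∀ A : E × T →L[ℝ] F,
      A.comp (D n θ) = (varBlock A).comp (fderiv ℝ (c n) θ) + paramBlock A := by
    intro A
    ext v
    simp [D, varBlock, paramBlock, ← map_add]
  rw [← hsplit]
  by_cases hd : DifferentiableAt ℝ f (c n θ, θ)
  · rw [hJd _ hd]
    exact (HasFDerivAt.comp (f := fun θ => (c n θ, θ)) θ hd.hasFDerivAt hγ).fderiv
  -- An element adapted to the curve `n` alone is already good: for almost every `θ`, any other
  -- curve through the same point has the same `D` and the same `B`. Countability of the family lets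
  -- the exceptional null sets be united.
  · obtain ⟨A, hA, hAD⟩ := exists_mem_clarkeJacobian_comp_eq_of_lipschitzOnWith hΩ hf
      (γ := fun θ => (c n θ, θ)) ⟨mem_univ _, hθ⟩ hγ (h2 n).hasFDerivAt
    have hg : A ∈ good (c n θ, θ) := by
      refine ⟨hA, fun m hm => ?_⟩
      have e1 : D m θ = D n θ := by simp only [D, h3 m hm (h1 m) (h1 n)]
      rw [e1, h4 m hm (h2 m) (h2 n)]
      exact hAD
    exact ((hJg _ hd ⟨A, hg⟩).2 n rfl).symm

end ChainRule

/-! ### Lipschitz bounds for the algorithm. -/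

section Algorithm

/-- A map which is Lipschitz in each variable, uniformly in the other, is Lipschitz. -/
theorem lipschitzOnWith_uncurry {A T F : Type*} [PseudoMetricSpace A] [PseudoMetricSpace T]
    [PseudoMetricSpace F] {f : A → T → F} {Θ : Set T} {L M : ℝ≥0}
    (h1 : ∀ θ ∈ Θ, LipschitzWith L fun a => f a θ) (h2 : ∀ a, LipschitzOnWith M (f a) Θ) :
    LipschitzOnWith (L + M) (fun p : A × T => f p.1 p.2) (univ ×ˢ Θ) := by
  refine LipschitzOnWith.of_dist_le_mul fun p hp q hq => ?_
  have e1 := (h1 p.2 hp.2).dist_le_mul p.1 q.1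
  have e2 := (h2 q.1).dist_le_mul p.2 hp.2 q.2 hq.2
  have e3 := mul_le_mul_of_nonneg_left (le_max_left (dist p.1 q.1) (dist p.2 q.2)) L.2
  have e4 := mul_le_mul_of_nonneg_left (le_max_right (dist p.1 q.1) (dist p.2 q.2)) M.2
  rw [← Prod.dist_eq] at e3 e4
  calc dist (f p.1 p.2) (f q.1 q.2) ≤ _ := dist_triangle _ (f q.1 p.2) _
    _ ≤ L * dist p q + M * dist p q := add_le_add (e1.trans e3) (e2.trans e4)
    _ = _ := by push_cast; ring

/-- The orbits of a Lipschitz map with a parameter are Lipschitz in the parameter. -/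
theorem exists_lipschitzOnWith_orbit {A T : Type*} [PseudoMetricSpace A] [PseudoMetricSpace T]
    {f : A × T → A} {c : ℕ → T → A} {Θ : Set T} {L : ℝ≥0}
    (hf : LipschitzOnWith L f (univ ×ˢ Θ)) (hc : ∀ ℓ θ, c (ℓ + 1) θ = f (c ℓ θ, θ))
    (h0 : ∃ M : ℝ≥0, LipschitzOnWith M (c 0) Θ) (ℓ : ℕ) :
    ∃ M : ℝ≥0, LipschitzOnWith M (c ℓ) Θ := by
  induction ℓ with
  | zero => exact h0
  | succ ℓ ih =>
    obtain ⟨M, hM⟩ := ih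
    rw [funext (hc ℓ)]
    exact ⟨_, hf.comp (hM.prodMk LipschitzWith.id.lipschitzOnWith) fun θ hθ => ⟨mem_univ _, hθ⟩⟩

variable {X U Y T : Type*}
  [NormedAddCommGroup X] [InnerProductSpace ℝ X] [CompleteSpace X]
  [NormedAddCommGroup U] [InnerProductSpace ℝ U] [CompleteSpace U]

/-- The dual point as a continuous linear map. -/
noncomputable def dualPointCLM (τ : ℝ) (K : X →L[ℝ] U) : X × X × U →L[ℝ] U :=
  (ContinuousLinearMap.snd ℝ X U).comp (ContinuousLinearMap.snd ℝ X (X × U)) +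
    τ • K.comp ((ContinuousLinearMap.fst ℝ X U).comp (ContinuousLinearMap.snd ℝ X (X × U)))

/-- The primal point as a continuous linear map. -/
noncomputable def primalPointCLM (ξ : ℝ) (K : X →L[ℝ] U) : (X × X × U) × U →L[ℝ] X :=
  (ContinuousLinearMap.fst ℝ X (X × U)).comp (ContinuousLinearMap.fst ℝ (X × X × U) U) -
    ξ • (ContinuousLinearMap.adjoint K).comp (ContinuousLinearMap.snd ℝ (X × X × U) U)

/-- The dual point of `(0, 0, u)` is `u`, so the last component of the step there is the dual
proximity operator at `u`. -/
theorem lipschitzOnWith_proxDual [PseudoMetricSpace T] {τ ξ ζ : ℝ} {K : X →L[ℝ] U}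
    {H : X → Y → T → EReal} {G : U → Y → T → EReal} {y : Y} {Θ : Set T} {L : ℝ≥0}
    (hstep : ∀ a, LipschitzOnWith L (fun θ => step τ ξ ζ K H G a y θ) Θ) (u : U) :
    LipschitzOnWith L (fun θ => proxDual τ G u y θ) Θ := by
  have h := LipschitzWith.prod_snd.comp_lipschitzOnWith
    (LipschitzWith.prod_snd.comp_lipschitzOnWith (hstep (0, 0, u)))
  simpa [Function.comp_def, step, dualPoint] using h

variable [FiniteDimensional ℝ X] [FiniteDimensional ℝ U]

theorem lipschitzWith_proxPrimal {ξ : ℝ} (hξ : 0 < ξ) {H : X → Y → T → EReal} {y : Y} {θ : T}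
    (hH : IsProperClosedConvex fun x => H x y θ) :
    LipschitzWith 1 fun x => proxPrimal ξ H x y θ :=
  LipschitzWith.of_dist_le_mul fun x x' => by
    simpa [dist_eq_norm, proxPrimal] using (hH.const_mul hξ).norm_prox_sub_le x x'

theorem lipschitzWith_proxDual {τ : ℝ} (hτ : 0 < τ) {G : U → Y → T → EReal} {y : Y} {θ : T}
    (hG : IsProperClosedConvex fun u => G u y θ) :
    LipschitzWith 1 fun u => proxDual τ G u y θ :=
  LipschitzWith.of_dist_le_mul fun u u' => by
    simpa [dist_eq_norm, proxDual] using (hG.conjugate.const_mul hτ).norm_prox_sub_le u u'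

/-- One step of the algorithm is Lipschitz, uniformly in the parameter. -/
theorem exists_lipschitzWith_step {τ ξ : ℝ} (hτ : 0 < τ) (hξ : 0 < ξ) (ζ : ℝ) (K : X →L[ℝ] U)
    {H : X → Y → T → EReal} {G : U → Y → T → EReal} {y : Y} {Θ : Set T}
    (hH : ∀ θ ∈ Θ, IsProperClosedConvex fun x => H x y θ)
    (hG : ∀ θ ∈ Θ, IsProperClosedConvex fun u => G u y θ) :
    ∃ L : ℝ≥0, ∀ θ ∈ Θ, LipschitzWith L fun a => step τ ξ ζ K H G a y θ := by
  have hu : ∀ θ ∈ Θ, LipschitzWith (1 * ‖dualPointCLM τ K‖₊)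
      fun a => proxDual τ G (dualPoint τ K a) y θ := fun θ hθ =>
    (lipschitzWith_proxDual hτ (hG θ hθ)).comp (dualPointCLM τ K).lipschitz
  have hx : ∀ θ ∈ Θ, LipschitzWith
      (1 * (‖primalPointCLM ξ K‖₊ * max 1 (1 * ‖dualPointCLM τ K‖₊)))
      fun a => proxPrimal ξ H (primalPoint ξ K a (proxDual τ G (dualPoint τ K a) y θ)) y θ :=
    fun θ hθ => (lipschitzWith_proxPrimal hξ (hH θ hθ)).comp
      ((primalPointCLM ξ K).lipschitz.comp (LipschitzWith.id.prodMk (hu θ hθ)))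
  have hfst : LipschitzWith 1 fun a : X × X × U => a.1 := LipschitzWith.prod_fst
  exact ⟨_, fun θ hθ => (hx θ hθ).prodMk
    (((hx θ hθ).add ((lipschitzWith_smul ζ).comp ((hx θ hθ).sub hfst))).prodMk (hu θ hθ))⟩

/-- The primal point of a step depends on `θ` through the dual update. Starting from `(x + S (u θ),
0, 0)` makes it equal to `x` at `θ`; at `θ'` it moves by `S (u θ - u θ')`, which nonexpansiveness in
the first variable and the Lipschitz bound for `u` control. -/
theorem exists_lipschitzOnWith_proxPrimal [PseudoMetricSpace T] {τ ξ ζ : ℝ} (hξ : 0 < ξ)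
    {K : X →L[ℝ] U} {H : X → Y → T → EReal} {G : U → Y → T → EReal} {y : Y} {Θ : Set T} {L : ℝ≥0}
    (hH : ∀ θ ∈ Θ, IsProperClosedConvex fun x => H x y θ)
    (hstep : ∀ a, LipschitzOnWith L (fun θ => step τ ξ ζ K H G a y θ) Θ) :
    ∃ M : ℝ≥0, ∀ x, LipschitzOnWith M (fun θ => proxPrimal ξ H x y θ) Θ := by
  set S : U →L[ℝ] X := ξ • ContinuousLinearMap.adjoint K with hS
  refine ⟨L + ‖S‖₊ * L, fun x => LipschitzOnWith.of_dist_le_mul fun θ hθ θ' hθ' => ?_⟩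
  set u : T → U := fun θ => proxDual τ G 0 y θ with hu
  have hpt : ∀ θ'', (step τ ξ ζ K H G (x + S (u θ), 0, 0) y θ'').1 =
      proxPrimal ξ H (x + S (u θ) - S (u θ'')) y θ'' := by
    intro θ''
    simp [step, dualPoint, primalPoint, hS, hu]
  have h1 := (LipschitzWith.prod_fst.comp_lipschitzOnWith
    (hstep (x + S (u θ), 0, 0))).dist_le_mul θ hθ θ' hθ'
  simp only [Function.comp_apply, hpt, add_sub_cancel_right, one_mul] at h1
  have h2 := (lipschitzWith_proxPrimal hξ (hH θ' hθ')).dist_le_mul (x + S (u θ) - S (u θ')) x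
  have h3 : dist (x + S (u θ) - S (u θ')) x ≤ ‖S‖₊ * (L * dist θ θ') := by
    rw [dist_eq_norm, add_sub_assoc, add_sub_cancel_left, ← dist_eq_norm]
    refine (S.lipschitz.dist_le_mul _ _).trans (mul_le_mul_of_nonneg_left ?_ (norm_nonneg _))
    exact (lipschitzOnWith_proxDual hstep 0).dist_le_mul θ hθ θ' hθ'
  rw [NNReal.coe_one, one_mul] at h2
  calc dist (proxPrimal ξ H x y θ) (proxPrimal ξ H x y θ')
      ≤ _ := dist_triangle _ (proxPrimal ξ H (x + S (u θ) - S (u θ')) y θ') _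
    _ ≤ L * dist θ θ' + ‖S‖₊ * (L * dist θ θ') := add_le_add h1 (h2.trans h3)
    _ = _ := by push_cast; ring

end Algorithm

end PrimalDual

/-! ### The theorem on differentiating the primal–dual iterates. -/

theorem mainTheorem11
    {X U Y T : Type*}
    [NormedAddCommGroup X] [InnerProductSpace ℝ X] [CompleteSpace X] [FiniteDimensional ℝ X]
    [MeasurableSpace X] [BorelSpace X]
    [NormedAddCommGroup U] [InnerProductSpace ℝ U] [CompleteSpace U] [FiniteDimensional ℝ U]
    [MeasurableSpace U] [BorelSpace U]
    [NormedAddCommGroup T] [InnerProductSpace ℝ T] [FiniteDimensional ℝ T]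
    [MeasurableSpace T] [BorelSpace T]
    (Θ : Set T) (hΘ : IsOpen Θ)
    (τ ξ ζ : ℝ) (hτ : 0 < τ) (hξ : 0 < ξ)
    (K : X →L[ℝ] U) (H : X → Y → T → EReal) (G : U → Y → T → EReal)
    (a₀ : Y → T → X × X × U) (y : Y)
    (hH : ∀ θ ∈ Θ, PrimalDual.IsProperClosedConvex (fun x => H x y θ))
    (hG : ∀ θ ∈ Θ, PrimalDual.IsProperClosedConvex (fun u => G u y θ))
    -- the iteration map is Lipschitz in `θ`, uniformly in `a`, and so is the initial point
    (hstep : ∃ L : ℝ≥0, ∀ a : X × X × U,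
      LipschitzOnWith L (fun θ => PrimalDual.step τ ξ ζ K H G a y θ) Θ)
    (hinit : ∃ L : ℝ≥0, LipschitzOnWith L (fun θ => a₀ y θ) Θ) :
    -- all iterates are weakly differentiable in `θ`
    (∀ ℓ : ℕ,
      PrimalDual.IsWeaklyDifferentiableOn
        (fun θ => PrimalDual.iter τ ξ ζ K H G a₀ ℓ y θ) Θ ∧
      PrimalDual.IsWeaklyDifferentiableOn
        (fun θ => (PrimalDual.iter τ ξ ζ K H G a₀ ℓ y θ).1) Θ ∧
      PrimalDual.IsWeaklyDifferentiableOn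
        (fun θ => (PrimalDual.iter τ ξ ζ K H G a₀ ℓ y θ).2.1) Θ ∧
      PrimalDual.IsWeaklyDifferentiableOn
        (fun θ => (PrimalDual.iter τ ξ ζ K H G a₀ ℓ y θ).2.2) Θ) ∧
    -- Jacobians of the iteration map and of the two proximity operators in (variable, `θ`)
    ∃ (JΨ : (X × X × U) × T → (X × X × U) × T →L[ℝ] X × X × U)
      (JG : U × T → U × T →L[ℝ] U) (JH : X × T → X × T →L[ℝ] X),
      PrimalDual.IsJacobianVersion
        (fun p : (X × X × U) × T => PrimalDual.step τ ξ ζ K H G p.1 y p.2) (univ ×ˢ Θ) JΨ ∧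
      PrimalDual.IsJacobianVersion
        (fun p : U × T => PrimalDual.proxDual τ G p.1 y p.2) (univ ×ˢ Θ) JG ∧
      PrimalDual.IsJacobianVersion
        (fun p : X × T => PrimalDual.proxPrimal ξ H p.1 y p.2) (univ ×ˢ Θ) JH ∧
      -- whatever the versions of the weak Jacobians of the iterates
      ∀ (Ja : ℕ → T → T →L[ℝ] X × X × U) (Jx Jxt : ℕ → T → T →L[ℝ] X) (Ju : ℕ → T → T →L[ℝ] U),
        (∀ ℓ, PrimalDual.IsWeakJacobian
          (fun θ => PrimalDual.iter τ ξ ζ K H G a₀ ℓ y θ) Θ (Ja ℓ)) →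
        (∀ ℓ, PrimalDual.IsWeakJacobian
          (fun θ => (PrimalDual.iter τ ξ ζ K H G a₀ ℓ y θ).1) Θ (Jx ℓ)) →
        (∀ ℓ, PrimalDual.IsWeakJacobian
          (fun θ => (PrimalDual.iter τ ξ ζ K H G a₀ ℓ y θ).2.1) Θ (Jxt ℓ)) →
        (∀ ℓ, PrimalDual.IsWeakJacobian
          (fun θ => (PrimalDual.iter τ ξ ζ K H G a₀ ℓ y θ).2.2) Θ (Ju ℓ)) →
        ∀ ℓ : ℕ, ∀ᵐ θ ∂(volume.restrict Θ),
          let a := PrimalDual.iter τ ξ ζ K H G a₀ ℓ y θ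
          let u' := (PrimalDual.iter τ ξ ζ K H G a₀ (ℓ + 1) y θ).2.2
          let dU := PrimalDual.dualPoint τ K a
          let pX := PrimalDual.primalPoint ξ K a u'
          let JU := Ju ℓ θ + τ • K.comp (Jxt ℓ θ)
          let JX := Jx ℓ θ - ξ • (ContinuousLinearMap.adjoint K).comp (Ju (ℓ + 1) θ)
          Jx ℓ θ = (fderiv ℝ PrimalDual.output a).comp (Ja ℓ θ) ∧
          Ja (ℓ + 1) θ = (PrimalDual.varBlock (JΨ (a, θ))).comp (Ja ℓ θ) +
            PrimalDual.paramBlock (JΨ (a, θ)) ∧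
          Ju (ℓ + 1) θ = (PrimalDual.varBlock (JG (dU, θ))).comp JU +
            PrimalDual.paramBlock (JG (dU, θ)) ∧
          Jx (ℓ + 1) θ = (PrimalDual.varBlock (JH (pX, θ))).comp JX +
            PrimalDual.paramBlock (JH (pX, θ)) ∧
          Jxt (ℓ + 1) θ = Jx (ℓ + 1) θ + ζ • (Jx (ℓ + 1) θ - Jx ℓ θ) := by

  obtain ⟨L₁, hL₁⟩ := PrimalDual.exists_lipschitzWith_step hτ hξ ζ K hH hG
  obtain ⟨L₂, hL₂⟩ := hstep
  obtain ⟨L₃, hL₃⟩ := PrimalDual.exists_lipschitzOnWith_proxPrimal hξ hH hL₂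
  have hψ := PrimalDual.lipschitzOnWith_uncurry hL₁ hL₂
  have hPG := PrimalDual.lipschitzOnWith_uncurry
    (fun θ hθ => PrimalDual.lipschitzWith_proxDual hτ (hG θ hθ))
    (PrimalDual.lipschitzOnWith_proxDual hL₂)
  have hPH := PrimalDual.lipschitzOnWith_uncurry
    (fun θ hθ => PrimalDual.lipschitzWith_proxPrimal hξ (hH θ hθ)) hL₃
  set it : ℕ → T → X × X × U := fun ℓ θ => PrimalDual.iter τ ξ ζ K H G a₀ ℓ y θ with hit
  have hsucc : ∀ ℓ θ, it (ℓ + 1) θ = PrimalDual.step τ ξ ζ K H G (it ℓ θ) y θ := fun _ _ => rfl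
  have ha : ∀ ℓ, ∃ M : ℝ≥0, LipschitzOnWith M (it ℓ) Θ :=
    PrimalDual.exists_lipschitzOnWith_orbit hψ hsucc hinit
  have hx : ∀ ℓ, ∃ M : ℝ≥0, LipschitzOnWith M (fun θ => (it ℓ θ).1) Θ := fun ℓ =>
    ⟨_, LipschitzWith.prod_fst.comp_lipschitzOnWith (ha ℓ).choose_spec⟩
  have hxt : ∀ ℓ, ∃ M : ℝ≥0, LipschitzOnWith M (fun θ => (it ℓ θ).2.1) Θ := fun ℓ =>
    ⟨_, LipschitzWith.prod_fst.comp_lipschitzOnWith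
      (LipschitzWith.prod_snd.comp_lipschitzOnWith (ha ℓ).choose_spec)⟩
  have hu : ∀ ℓ, ∃ M : ℝ≥0, LipschitzOnWith M (fun θ => (it ℓ θ).2.2) Θ := fun ℓ =>
    ⟨_, LipschitzWith.prod_snd.comp_lipschitzOnWith
      (LipschitzWith.prod_snd.comp_lipschitzOnWith (ha ℓ).choose_spec)⟩
  have hdU : ∀ ℓ, ∃ M : ℝ≥0,
      LipschitzOnWith M (fun θ => PrimalDual.dualPoint τ K (it ℓ θ)) Θ := fun ℓ =>
    ⟨_, (PrimalDual.dualPointCLM τ K).lipschitz.comp_lipschitzOnWith (ha ℓ).choose_spec⟩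
  have hpX : ∀ ℓ, ∃ M : ℝ≥0, LipschitzOnWith M
      (fun θ => PrimalDual.primalPoint ξ K (it ℓ θ) (it (ℓ + 1) θ).2.2) Θ := fun ℓ =>
    ⟨_, (PrimalDual.primalPointCLM ξ K).lipschitz.comp_lipschitzOnWith
      ((ha ℓ).choose_spec.prodMk (hu (ℓ + 1)).choose_spec)⟩
  refine ⟨fun ℓ => ⟨?_, ?_, ?_, ?_⟩, ?_⟩
  · exact PrimalDual.isWeaklyDifferentiableOn_of_lipschitzOnWith hΘ (ha ℓ).choose_spec
  · exact PrimalDual.isWeaklyDifferentiableOn_of_lipschitzOnWith hΘ (hx ℓ).choose_spec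
  · exact PrimalDual.isWeaklyDifferentiableOn_of_lipschitzOnWith hΘ (hxt ℓ).choose_spec
  · exact PrimalDual.isWeaklyDifferentiableOn_of_lipschitzOnWith hΘ (hu ℓ).choose_spec
  have hXU : (volume : Measure (X × U)).IsAddHaarMeasure :=
    inferInstanceAs (((volume : Measure X).prod (volume : Measure U)).IsAddHaarMeasure)
  have hXXU : (volume : Measure (X × X × U)).IsAddHaarMeasure :=
    inferInstanceAs (((volume : Measure X).prod (volume : Measure (X × U))).IsAddHaarMeasure)
  -- Each version is adapted to the whole sequence of curves along which its map is evaluated: the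
  -- iterates, the dual points and the primal points. It therefore depends on the initial point but
  -- not on `ℓ`.
  obtain ⟨JΨ, hJΨ, hΨ⟩ := PrimalDual.exists_isJacobianVersion_chain hΘ hψ it ha
  obtain ⟨JG, hJG, hGc⟩ := PrimalDual.exists_isJacobianVersion_chain hΘ hPG _ hdU
  obtain ⟨JH, hJH, hHc⟩ := PrimalDual.exists_isJacobianVersion_chain hΘ hPH _ hpX
  refine ⟨JΨ, JG, JH, hJΨ, hJG, hJH, fun Ja Jx Jxt Ju hJa hJx hJxt hJu ℓ => ?_⟩
  have had := PrimalDual.ae_differentiableAt_of_lipschitzOnWith volume hΘ (ha ℓ).choose_spec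
  have had' := PrimalDual.ae_differentiableAt_of_lipschitzOnWith volume hΘ (ha (ℓ + 1)).choose_spec
  filter_upwards [had, had', hΨ ℓ, hGc ℓ, hHc ℓ,
    (hJa ℓ).ae_eq_fderiv hΘ (ha ℓ).choose_spec,
    (hJa (ℓ + 1)).ae_eq_fderiv hΘ (ha (ℓ + 1)).choose_spec,
    (hJx ℓ).ae_eq_fderiv hΘ (hx ℓ).choose_spec,
    (hJx (ℓ + 1)).ae_eq_fderiv hΘ (hx (ℓ + 1)).choose_spec,
    (hJxt ℓ).ae_eq_fderiv hΘ (hxt ℓ).choose_spec,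
    (hJxt (ℓ + 1)).ae_eq_fderiv hΘ (hxt (ℓ + 1)).choose_spec,
    (hJu ℓ).ae_eq_fderiv hΘ (hu ℓ).choose_spec,
    (hJu (ℓ + 1)).ae_eq_fderiv hΘ (hu (ℓ + 1)).choose_spec]
    with θ d d' cΨ cG cH ea ea' ex ex' ext ext' eu eu'
  have dx := d.hasFDerivAt.fst
  have dxt := d.hasFDerivAt.snd.fst
  have du := d.hasFDerivAt.snd.snd
  have dx' := d'.hasFDerivAt.fst
  have du' := d'.hasFDerivAt.snd.snd
  -- The dual and primal points are linear in the iterates, so their derivatives are exactly the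
  -- combinations to which the blocks of `JG` and `JH` are applied.
  have hdual : fderiv ℝ (fun θ => PrimalDual.dualPoint τ K (it ℓ θ)) θ =
      Ju ℓ θ + τ • K.comp (Jxt ℓ θ) := by
    rw [eu, ext, du.fderiv, dxt.fderiv]
    exact (du.add ((K.hasFDerivAt.comp θ dxt).const_smul τ)).fderiv
  have hprimal : fderiv ℝ
      (fun θ => PrimalDual.primalPoint ξ K (it ℓ θ) (it (ℓ + 1) θ).2.2) θ =
      Jx ℓ θ - ξ • (ContinuousLinearMap.adjoint K).comp (Ju (ℓ + 1) θ) := by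
    rw [eu', ex, du'.fderiv, dx.fderiv]
    exact (dx.sub (((ContinuousLinearMap.adjoint K).hasFDerivAt.comp θ du').const_smul ξ)).fderiv
  refine ⟨?_, ?_, ?_, ?_, ?_⟩
  · rw [ex, ea, dx.fderiv]
    congr 1
    exact (hasFDerivAt_fst.fderiv).symm
  · rw [ea', ea]
    exact cΨ
  · rw [← hdual, eu']
    exact cG
  · rw [← hprimal, ex']
    exact cH
  · rw [ext', ex', ex, dx'.fderiv, dx.fderiv]
    exact (dx'.add ((dx'.sub dx).const_smul ζ)).fderiv
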